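/- A growth function is a nondecreasing $\Phi:[0,\infty)\to[0,\infty)$ with $\lim_{t\to0}\Phi(t)=\Phi(0)=0$, $\Phi(t)>0$ for $t>0$, and $\lim_{t\to\infty}\Phi(t)=\infty$. Let $\mathscr U$ be the set of convex growth functions $\Phi\in\mathscr C^1([0,\infty))$ such that $t\mapsto\Phi(t)/t$ is nondecreasing on $(0,\infty)$ and such that, for some $p\ge1$ and $C>1$, $\Phi(st)\le Ct^p\Phi(s)$ for all $t\ge1$, $s\ge0$. A function $\Theta:[0,\infty)\to[0,\infty]$ satisfies $\Delta_2$ if there is $K>1$ with $\Theta(2t)\le K\Theta(t)$ for all $t>0$, and $\Phi\in\nabla_2$ means that both $\Phi$ and its complementary function $\Psi(s)=\sup_{t\ge0}\{st-\Phi(t)\}\in[0,\infty]$ satisfy $\Delta_2$. Let $\mathbb C_+=\{x+iy:y>0\}$ and $\alpha>-1$. For a function $F$ on $\mathbb C_+$ put $$\|F\|_{A^\Phi_\alpha}=\inf\Big\{\lambda>0:\int_{\mathbb C_+}\Phi\Big(\frac{|F(x+iy)|}{\lambda}\Big)y^\alpha\,dx\,dy\le1\Big\}\qquad(\inf\emptyset=\infty),$$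 and let $A^\Phi_\alpha$ be the space of analytic $F$ on $\mathbb C_+$ with $\|F\|_{A^\Phi_\alpha}<\infty$. For $0<\delta<1$ call a real number $\gamma$ admissible for $\delta$ if $$\frac{\log\left(\frac{1+\delta^2/20}{1-\delta^2/20}\right)}{4\log2}<\gamma<\frac{\log\left(\frac{1+\delta^2/4}{1-\delta^2/4}\right)}{4\log2},$$ and for such $\gamma$ and $l,j\in\mathbb Z$ put $z_{l,j}=\delta^2l\,2^{\gamma j-3}+i2^{\gamma j}$. For a complex family $\mu=(\mu_{l,j})_{l,j\in\mathbb Z}$ put $$\|\mu\|_{\ell^\Phi_\alpha}=\inf\Big\{\lambda>0:\sum_{j\in\mathbb Z}\sum_{l\in\mathbb Z}\Phi\Big(\frac{|\mu_{l,j}|}{\lambda}\Big)2^{j\gamma(\alpha+2)}\le1\Big\},$$ and let $\ell^\Phi_\alpha$ be the set of $\mu$ for which this is finite. Put $c_\alpha=2^{\alpha+2}$ and $$F_\mu(z)=c_\alpha\sum_{j\in\mathbb Z}\sum_{l\in\mathbb Z}\mu_{l,j}\Big(\frac{z-\overline{z_{l,j}}}{i}\Big)^{-\alpha-2}2^{j\gamma(\alpha+2)},\qquad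 z\in\mathbb C_+,$$ with the principal branch of the power. Theorem. Let $\alpha>-1$ and $\Phi\in\mathscr U\cap\nabla_2$. (i) For every $0<\delta<1$ there is a constant $C_1>0$, depending only on $\Phi,\delta,\alpha$, such that for every admissible $\gamma$ and every $\mu\in\ell^\Phi_\alpha$ the series defining $F_\mu$ converges absolutely at every point of $\mathbb C_+$, $F_\mu\in A^\Phi_\alpha$, and $\|F_\mu\|_{A^\Phi_\alpha}\le C_1\|\mu\|_{\ell^\Phi_\alpha}$. (ii) There is $\delta_0>0$, depending only on $\Phi$ and $\alpha$, such that for every $0<\delta<1$ with $\delta<\delta_0$ there is a constant $C_2>0$, depending only on $\Phi,\delta,\alpha$, such that for every admissible $\gamma$ and every $F\in A^\Phi_\alpha$ there is $\mu\in\ell^\Phi_\alpha$ for which the series defining $F_\mu$ converges absolutely at every point of $\mathbb C_+$, $F(z)=F_\mu(z)$ for all $z\in\mathbb C_+$, and $\|F\|_{A^\Phi_\alpha}\le C_2\|\mu\|_{\ell^\Phi_\alpha}$. -/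

import Mathlib

open Set Filter Topology MeasureTheory
open scoped ENNReal

noncomputable section

namespace BergmanOrlicz

/-! Functions `Φ : [0, ∞) → [0, ∞)` are represented by functions `ℝ → ℝ` of which only the
values on `[0, ∞)` are used. -/

/-- Growth functions on `[0, ∞)`. -/
structure IsGrowthFunction (Φ : ℝ → ℝ) : Prop where
  monotoneOn : MonotoneOn Φ (Ici 0)
  map_zero : Φ 0 = 0
  tendsto_zero : Tendsto Φ (𝓝[>] 0) (𝓝 0)
  pos : ∀ t : ℝ, 0 < t → 0 < Φ t
  tendsto_atTop : Tendsto Φ atTop atTop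

/-- `Φ` is of upper type `p`. -/
def IsUpperType (p : ℝ) (Φ : ℝ → ℝ) : Prop :=
  ∃ C : ℝ, 1 < C ∧ ∀ t : ℝ, 1 ≤ t → ∀ s : ℝ, 0 ≤ s → Φ (s * t) ≤ C * t ^ p * Φ s

/-- The class `𝒰`: growth functions of some upper type `p ≥ 1` for which `Φ(t)/t` is
nondecreasing on `(0, ∞)`, and which are convex and continuously differentiable on `[0, ∞)`. -/
structure ClassU (Φ : ℝ → ℝ) : Prop where
  growth : IsGrowthFunction Φ
  upperType : ∃ p : ℝ, 1 ≤ p ∧ IsUpperType p Φ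
  div_monotoneOn : MonotoneOn (fun t : ℝ => Φ t / t) (Ioi 0)
  contDiffOn : ContDiffOn ℝ 1 Φ (Ici 0)
  convexOn : ConvexOn ℝ (Ici 0) Φ

/-- The complementary function `Ψ(s) = sup_{t ≥ 0} (s t - Φ(t))`, with values in `[0, ∞]`.
Since `Φ(0) = 0`, the supremum is nonnegative, so cutting the terms off at `0` does not
change it. -/
def complementary (Φ : ℝ → ℝ) (s : ℝ) : ℝ≥0∞ :=
  ⨆ (t : ℝ) (_ : 0 ≤ t), ENNReal.ofReal (s * t - Φ t)

/-- The `Δ₂`-condition for a function on `[0, ∞)` with values in `[0, ∞]`. -/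
def Delta2 (Φ : ℝ → ℝ≥0∞) : Prop :=
  ∃ K : ℝ, 1 < K ∧ ∀ t : ℝ, 0 < t → Φ (2 * t) ≤ ENNReal.ofReal K * Φ t

/-- The `∇₂`-condition: `Φ` and its complementary function both satisfy `Δ₂`. -/
def Nabla2 (Φ : ℝ → ℝ) : Prop :=
  Delta2 (fun t => ENNReal.ofReal (Φ t)) ∧ Delta2 (complementary Φ)

/-- The open upper half-plane `ℂ₊`. -/
def upperHalf : Set ℂ := {z : ℂ | 0 < z.im}

/-- The measure `dV_α = y^α dx dy` on `ℂ₊`. -/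
def weightedVolume (α : ℝ) : Measure ℂ :=
  (volume.restrict upperHalf).withDensity (fun z => ENNReal.ofReal (z.im ^ α))

/-- The Luxemburg (quasi-)norm of `f` in `L^Φ(X, m)`, with value `∞` if no `lam` is
admissible. -/
def luxNorm {X : Type*} [MeasurableSpace X] (m : Measure X) (Φ : ℝ → ℝ) (f : X → ℂ) : ℝ≥0∞ :=
  ⨅ (lam : ℝ) (_ : 0 < lam ∧ ∫⁻ x, ENNReal.ofReal (Φ (‖f x‖ / lam)) ∂m ≤ 1),
    ENNReal.ofReal lam

/-- The norm of the Bergman–Orlicz space `A^Φ_α(ℂ₊)`. It depends only on `F` on `ℂ₊`. -/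
def bergmanNorm (α : ℝ) (Φ : ℝ → ℝ) (F : ℂ → ℂ) : ℝ≥0∞ :=
  luxNorm (weightedVolume α) Φ F

/-- `F` (restricted to `ℂ₊`) belongs to the Bergman–Orlicz space `A^Φ_α(ℂ₊)`. -/
def MemBergman (α : ℝ) (Φ : ℝ → ℝ) (F : ℂ → ℂ) : Prop :=
  DifferentiableOn ℂ F upperHalf ∧ bergmanNorm α Φ F < ∞

/-- The condition on the real number `γ` attached to `δ`. -/
def IsLatticeExponent (δ γ : ℝ) : Prop :=
  Real.log ((1 + δ ^ 2 / 20) / (1 - δ ^ 2 / 20)) / (4 * Real.log 2) < γ ∧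
    γ < Real.log ((1 + δ ^ 2 / 4) / (1 - δ ^ 2 / 4)) / (4 * Real.log 2)

/-- The `δ`-lattice `z_{l,j} = δ² l 2^{γ j - 3} + i 2^{γ j}`. -/
def latticePoint (δ γ : ℝ) (l j : ℤ) : ℂ :=
  ((δ ^ 2 * l * (2 : ℝ) ^ (γ * j - 3) : ℝ) : ℂ) + Complex.I * (((2 : ℝ) ^ (γ * j) : ℝ) : ℂ)

/-- The weight `2^{j γ (α + 2)}`. -/
def latticeWeight (α γ : ℝ) (j : ℤ) : ℝ := (2 : ℝ) ^ (j * γ * (α + 2))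

/-- The Luxemburg norm of `μ = (μ_{l,j})` in `ℓ^Φ_α(ℂ₊)`, with value `∞` if no `lam` is
admissible. -/
def seqNorm (α γ : ℝ) (Φ : ℝ → ℝ) (μ : ℤ → ℤ → ℂ) : ℝ≥0∞ :=
  ⨅ (lam : ℝ) (_ : 0 < lam ∧
      ∑' (j : ℤ) (l : ℤ), ENNReal.ofReal (Φ (‖μ l j‖ / lam) * latticeWeight α γ j) ≤ 1),
    ENNReal.ofReal lam

/-- `μ` belongs to `ℓ^Φ_α(ℂ₊)`. -/
def MemSeq (α γ : ℝ) (Φ : ℝ → ℝ) (μ : ℤ → ℤ → ℂ) : Prop := seqNorm α γ Φ μ < ∞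

/-- The Bergman kernel `K_α(z, w) = ((z - conj w) / i)^(-α-2)`. For `z, w ∈ ℂ₊` the base has
positive real part, and the power is the principal one. -/
def kernel (α : ℝ) (z w : ℂ) : ℂ :=
  ((z - (starRingEnd ℂ) w) / Complex.I) ^ (((-α - 2 : ℝ)) : ℂ)

/-- The `(l, j)` term `μ_{l,j} K_α(z, z_{l,j}) 2^{j γ (α + 2)}` of the atomic series. -/
def atom (α δ γ : ℝ) (μ : ℤ → ℤ → ℂ) (z : ℂ) (l j : ℤ) : ℂ :=
  μ l j * kernel α z (latticePoint δ γ l j) * ((latticeWeight α γ j : ℝ) : ℂ)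

/-- The constant `c_α = 2^{α + 2}`. -/
def cConst (α : ℝ) : ℂ := (((2 : ℝ) ^ (α + 2) : ℝ) : ℂ)

/-- `F_μ(z) = c_α ∑_j ∑_l μ_{l,j} K_α(z, z_{l,j}) 2^{j γ (α + 2)}`. -/
def atomicSum (α δ γ : ℝ) (μ : ℤ → ℤ → ℂ) (z : ℂ) : ℂ :=
  cConst α * ∑' (j : ℤ) (l : ℤ), atom α δ γ μ z l j

/-- The atomic series of `μ` converges absolutely, as a double series, at every point
of `ℂ₊`. -/
def AtomicSummable (α δ γ : ℝ) (μ : ℤ → ℤ → ℂ) : Prop :=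
  ∀ z ∈ upperHalf, Summable (fun p : ℤ × ℤ => atom α δ γ μ z p.1 p.2)

end BergmanOrlicz

end

/-!
The theorem follows from one operator bound and one identity. Write `V` for the measure
`y ^ α dx dy` on `ℂ₊` and `T g (z) = ∫ |z - conj w| ^ (-α - 2) g(w) dV(w)` for the positive Bergman
operator.

*The bound.* `T` is bounded on `L^Φ(V)` (`ClassU.modular_posOp_le`). The substitution `w ↦ x + y w`
writes `T` as a superposition of the dilations `g ↦ g(x + y w)`, each of which multiplies the
integral of a function against `V` by `(im w) ^ (-α - 1)`. Since `Φ` is of some upper type `q`, and,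
because its complementary function is `Δ₂`, of some lower type `p > 1`
(`ClassU.exists_lowerType`), the norm of such a dilation on `L^Φ` is at most a constant times
`(im w) ^ (-(α + 1) / p) + (im w) ^ (-(α + 1) / q)`. These norms are integrable against the kernel
(`lintegral_absKernel_rpow_lt_top`), and Jensen's inequality concludes.

*The identity.* A holomorphic `F` with `T |F| < ∞` satisfies
`∫ K(z, w) F(w) dV(w) = c F(z)` (`reproducing`). By an affine automorphism one may take `z = i`;
the Cayley transform then turns the identity into the mean value property on circles, for the
function `F / K(·, i)`. Hence `|F| ≤ C T |F|`, and the oscillation of `F` over a hyperbolic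
distance `ε` is at most `C ε T |F|` (`exists_enorm_le_posOp`).

*Synthesis.* On each lattice cell the kernel is comparable to its value at the lattice point, so
`F_μ` is dominated by `T` applied to the step function with values `|μ_{l,j}|`
(`tsum_enorm_atom_le`), and `‖F_μ‖ ≤ C ‖μ‖` follows.

*Decomposition.* The Riemann sum `S F` of the reproducing formula over the cells is an atomic
series, and `|F - S F| ≤ C δ² T (T |F|)` (`exists_remainder_bound`). For small `δ` the error
operator halves norms, so that iterating `F_{n+1} = F_n - S F_n` and adding up the coefficients of
the `S F_n` gives `μ` with `F = F_μ`. The norm inequality in the second part is then the one for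
synthesis.
-/

noncomputable section

namespace BergmanOrlicz

/-! ### Growth functions on `[0, ∞]` and Jensen's inequality -/

/-- The extension of `Φ` to a function `[0, ∞] → [0, ∞]` with value `∞` at `∞`. -/
def extPhi (Φ : ℝ → ℝ) (x : ℝ≥0∞) : ℝ≥0∞ :=
  if x = ∞ then ∞ else ENNReal.ofReal (Φ x.toReal)

section Growth

variable {Φ : ℝ → ℝ}

@[simp] lemma extPhi_top : extPhi Φ ∞ = ∞ := by simp [extPhi]

lemma extPhi_ofReal {t : ℝ} (ht : 0 ≤ t) :
    extPhi Φ (ENNReal.ofReal t) = ENNReal.ofReal (Φ t) := by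
  simp [extPhi, ENNReal.toReal_ofReal ht]

lemma extPhi_enorm_div (z : ℂ) {lam : ℝ} (hl : 0 < lam) :
    extPhi Φ (‖z‖ₑ / ENNReal.ofReal lam) = ENNReal.ofReal (Φ (‖z‖ / lam)) := by
  rw [← ofReal_norm, ← ENNReal.ofReal_div_of_pos hl, extPhi_ofReal (by positivity)]

lemma IsGrowthFunction.nonneg (h : IsGrowthFunction Φ) {t : ℝ} (ht : 0 ≤ t) : 0 ≤ Φ t := by
  rcases ht.eq_or_lt with rfl | ht
  · exact h.map_zero.ge
  · exact (h.pos t ht).le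

lemma IsGrowthFunction.extPhi_zero (h : IsGrowthFunction Φ) : extPhi Φ 0 = 0 := by
  simp [extPhi, h.map_zero]

lemma IsGrowthFunction.extPhi_mono (h : IsGrowthFunction Φ) : Monotone (extPhi Φ) := by
  intro x y hxy
  rcases eq_or_ne y ∞ with rfl | hy
  · simp
  have hx : x ≠ ∞ := ne_top_of_le_ne_top hy hxy
  simp only [extPhi, hx, hy, if_false]
  exact ENNReal.ofReal_le_ofReal (h.monotoneOn ENNReal.toReal_nonneg ENNReal.toReal_nonneg
    (ENNReal.toReal_mono hy hxy))

lemma IsGrowthFunction.measurable_extPhi (h : IsGrowthFunction Φ) : Measurable (extPhi Φ) :=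
  h.extPhi_mono.measurable

/-- A pointwise inequality between multiples of `Φ` passes to the extension to `[0, ∞]`. -/
lemma extPhi_le_of_forall {a b : ℝ} (ha : 0 < a) (hb : 0 < b)
    (H : ∀ t : ℝ, 0 ≤ t → Φ (a * t) ≤ b * Φ t) (x : ℝ≥0∞) :
    extPhi Φ (ENNReal.ofReal a * x) ≤ ENNReal.ofReal b * extPhi Φ x := by
  rcases eq_or_ne x ∞ with rfl | hx
  · simp [hb]
  obtain ⟨t, ht, rfl⟩ : ∃ t : ℝ, 0 ≤ t ∧ x = ENNReal.ofReal t :=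
    ⟨x.toReal, ENNReal.toReal_nonneg, (ENNReal.ofReal_toReal hx).symm⟩
  rw [← ENNReal.ofReal_mul ha.le, extPhi_ofReal (by positivity), extPhi_ofReal ht,
    ← ENNReal.ofReal_mul hb.le]
  exact ENNReal.ofReal_le_ofReal (H t ht)

/-- At each `t₀ > 0` the graph of `Φ` lies above a line through `(t₀, Φ t₀)`; as `Φ 0 = 0`, this
line has slope at least `Φ t₀ / t₀`. -/
lemma ClassU.exists_slope (h : ClassU Φ) {t₀ : ℝ} (ht₀ : 0 < t₀) :
    ∃ m : ℝ, 0 < m ∧ Φ t₀ ≤ m * t₀ ∧ ∀ t : ℝ, 0 ≤ t → Φ t₀ + m * (t - t₀) ≤ Φ t := by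
  have hd : DifferentiableAt ℝ Φ t₀ :=
    (h.contDiffOn.differentiableOn (by norm_num)).differentiableAt (Ici_mem_nhds ht₀)
  have key : ∀ t : ℝ, 0 ≤ t → Φ t₀ + deriv Φ t₀ * (t - t₀) ≤ Φ t := by
    intro t ht
    rcases lt_trichotomy t t₀ with hlt | rfl | hlt
    · have := h.convexOn.slope_le_deriv (x := t) (y := t₀) ht ht₀.le hlt hd
      rw [slope_def_field, div_le_iff₀ (by linarith)] at this
      linarith
    · simp
    · have := h.convexOn.deriv_le_slope (x := t₀) (y := t) ht₀.le ht hlt hd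
      rw [slope_def_field, le_div_iff₀ (by linarith)] at this
      linarith
  have h0 := key 0 le_rfl
  rw [h.growth.map_zero] at h0
  have hpos := h.growth.pos t₀ ht₀
  refine ⟨deriv Φ t₀, ?_, by linarith, key⟩
  by_contra hcon
  nlinarith

/-- Jensen's inequality for measures of total mass at most `1`. -/
lemma ClassU.jensen (h : ClassU Φ) {X : Type*} [MeasurableSpace X] (ν : Measure X)
    (hν : ν univ ≤ 1) {f : X → ℝ≥0∞} (hf : Measurable f) :
    extPhi Φ (∫⁻ x, f x ∂ν) ≤ ∫⁻ x, extPhi Φ (f x) ∂ν := by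
  set I := ∫⁻ x, f x ∂ν with hI
  have key : ∀ t₀ : ℝ, 0 < t₀ → ∃ m : ℝ, 0 < m ∧ Φ t₀ ≤ m * t₀ ∧
      ENNReal.ofReal m * I ≤ ∫⁻ x, extPhi Φ (f x) ∂ν + ENNReal.ofReal (m * t₀ - Φ t₀) := by
    intro t₀ ht₀
    obtain ⟨m, hm, hm', hline⟩ := h.exists_slope ht₀
    refine ⟨m, hm, hm', ?_⟩
    have hpt : ∀ x, ENNReal.ofReal m * f x ≤ extPhi Φ (f x) + ENNReal.ofReal (m * t₀ - Φ t₀) := by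
      intro x
      rcases eq_or_ne (f x) ∞ with hx | hx
      · simp [hx]
      obtain ⟨t, ht, hxt⟩ : ∃ t : ℝ, 0 ≤ t ∧ f x = ENNReal.ofReal t :=
        ⟨_, ENNReal.toReal_nonneg, (ENNReal.ofReal_toReal hx).symm⟩
      rw [hxt, extPhi_ofReal ht, ← ENNReal.ofReal_mul hm.le,
        ← ENNReal.ofReal_add (h.growth.nonneg ht) (by linarith)]
      exact ENNReal.ofReal_le_ofReal (by linarith [hline t ht])
    calc ENNReal.ofReal m * I = ∫⁻ x, ENNReal.ofReal m * f x ∂ν :=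
          (lintegral_const_mul _ hf).symm
      _ ≤ ∫⁻ x, (extPhi Φ (f x) + ENNReal.ofReal (m * t₀ - Φ t₀)) ∂ν := lintegral_mono hpt
      _ = ∫⁻ x, extPhi Φ (f x) ∂ν + ENNReal.ofReal (m * t₀ - Φ t₀) * ν univ := by
          rw [lintegral_add_right _ measurable_const, lintegral_const]
      _ ≤ _ := by gcongr; exact mul_le_of_le_one_right' hν
  rcases eq_or_ne I ∞ with hItop | hItop
  · obtain ⟨m, hm, -, hle⟩ := key 1 one_pos
    rw [hItop, ENNReal.mul_top (by simpa using hm), top_le_iff, ENNReal.add_eq_top] at hle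
    rcases hle with hle | hle
    · simp [hle]
    · exact absurd hle ENNReal.ofReal_ne_top
  rcases eq_or_ne I 0 with hI0 | hI0
  · simp [hI0, h.growth.extPhi_zero]
  have hpos : 0 < I.toReal := ENNReal.toReal_pos hI0 hItop
  obtain ⟨m, hm, hm', hle⟩ := key I.toReal hpos
  have e1 : ENNReal.ofReal m * I =
      ENNReal.ofReal (Φ I.toReal) + ENNReal.ofReal (m * I.toReal - Φ I.toReal) := by
    rw [← ENNReal.ofReal_add (h.growth.nonneg hpos.le) (by linarith)]
    conv_lhs => rw [← ENNReal.ofReal_toReal hItop]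
    rw [← ENNReal.ofReal_mul hm.le]
    congr 1; ring
  rw [e1] at hle
  have := (ENNReal.add_le_add_iff_right ENNReal.ofReal_ne_top).1 hle
  simpa [extPhi, hItop] using this

/-- Jensen's inequality for countable sums. -/
lemma ClassU.jensen_tsum (h : ClassU Φ) {ι : Type*} [Countable ι] {w : ι → ℝ≥0∞}
    (hw : ∑' i, w i ≤ 1) (x : ι → ℝ≥0∞) :
    extPhi Φ (∑' i, w i * x i) ≤ ∑' i, w i * extPhi Φ (x i) := by
  let _ : MeasurableSpace ι := ⊤
  have hm : ∀ y : ι → ℝ≥0∞, ∫⁻ i, y i ∂(Measure.count.withDensity w) = ∑' i, w i * y i := by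
    intro y
    rw [lintegral_withDensity_eq_lintegral_mul _ measurable_from_top measurable_from_top,
      lintegral_count]
    simp
  have := h.jensen (Measure.count.withDensity w) (by
    rw [← lintegral_one, hm]; simpa using hw) (f := x) measurable_from_top
  rwa [hm, hm] at this

lemma ClassU.extPhi_div_le (h : ClassU Φ) {c : ℝ} (hc : 1 ≤ c) (x : ℝ≥0∞) :
    extPhi Φ (x / ENNReal.ofReal c) ≤ extPhi Φ x / ENNReal.ofReal c := by
  have hc1 : (ENNReal.ofReal c)⁻¹ ≤ 1 := by
    rw [ENNReal.inv_le_one]; simpa using ENNReal.ofReal_le_ofReal hc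
  have := h.jensen_tsum (ι := Unit) (w := fun _ => (ENNReal.ofReal c)⁻¹)
    (by simpa using hc1) (fun _ => x)
  simpa [div_eq_mul_inv, mul_comm] using this

/-! ### Lower and upper types -/

/-- If the complementary function satisfies `Δ₂`, then `Φ (ρ t) ≤ (ρ / 2) Φ t` for some `ρ < 1`:
apply `Ψ (2 s) ≤ K Ψ s`, `K = 2 / ρ`, to the slope `s` of a supporting line of `Φ` at `ρ t`. -/
lemma ClassU.exists_contraction (h : ClassU Φ) (hΨ : Delta2 (complementary Φ)) :
    ∃ ρ : ℝ, 0 < ρ ∧ ρ < 1 ∧ ∀ t : ℝ, 0 ≤ t → Φ (ρ * t) ≤ ρ / 2 * Φ t := by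
  obtain ⟨K₀, hK₀, hΔ⟩ := hΨ
  set K := K₀ + 2
  have hK : 2 < K := by simp only [K]; linarith
  refine ⟨2 / K, by positivity, (div_lt_one (by linarith)).2 hK, fun t ht => ?_⟩
  rcases ht.eq_or_lt with rfl | ht
  · simp [h.growth.map_zero]
  set r := 2 / K * t
  have hr : 0 < r := by positivity
  obtain ⟨s, hs, hs', hline⟩ := h.exists_slope hr
  have hΨs : complementary Φ s ≤ ENNReal.ofReal (s * r - Φ r) := by
    refine iSup₂_le fun u hu => ENNReal.ofReal_le_ofReal ?_
    linarith [hline u hu]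
  have h1 : ENNReal.ofReal (2 * s * t - Φ t) ≤ ENNReal.ofReal (K * (s * r - Φ r)) := by
    calc ENNReal.ofReal (2 * s * t - Φ t) ≤ complementary Φ (2 * s) :=
          le_iSup₂ (f := fun (u : ℝ) (_ : 0 ≤ u) => ENNReal.ofReal (2 * s * u - Φ u)) t ht.le
      _ ≤ ENNReal.ofReal K₀ * complementary Φ s := hΔ s hs
      _ ≤ ENNReal.ofReal K * ENNReal.ofReal (s * r - Φ r) := by
          gcongr; simp only [K]; linarith
      _ = _ := (ENNReal.ofReal_mul (by linarith)).symm
  rw [ENNReal.ofReal_le_ofReal_iff (mul_nonneg (by linarith) (by linarith))] at h1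
  have e : K * (s * r) = 2 * s * t := by simp only [r]; field_simp
  have h2 : K * Φ r ≤ Φ t := by linarith
  have hK0 : (0 : ℝ) < K := by linarith
  calc Φ r = K * Φ r / K := by field_simp
    _ ≤ Φ t / K := by gcongr
    _ = 2 / K / 2 * Φ t := by field_simp

/-- A convex growth function whose complementary function satisfies `Δ₂` has a lower type
`p > 1`. -/
lemma ClassU.exists_lowerType (h : ClassU Φ) (hΨ : Delta2 (complementary Φ)) :
    ∃ p C : ℝ, 1 < p ∧ 1 ≤ C ∧
      ∀ s : ℝ, 0 < s → s ≤ 1 → ∀ t : ℝ, 0 ≤ t → Φ (s * t) ≤ C * s ^ p * Φ t := by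
  obtain ⟨ρ, hρ, hρ1, hcon⟩ := h.exists_contraction hΨ
  set p := Real.logb ρ (ρ / 2)
  have hp : ρ ^ p = ρ / 2 := Real.rpow_logb hρ hρ1.ne (by positivity)
  have hp1 : 1 < p := by
    by_contra hcon
    have := Real.rpow_le_rpow_of_exponent_ge hρ hρ1.le (not_lt.1 hcon)
    rw [hp, Real.rpow_one] at this
    linarith
  have hiter : ∀ n : ℕ, ∀ t : ℝ, 0 ≤ t → Φ (ρ ^ n * t) ≤ (ρ / 2) ^ n * Φ t := by
    intro n
    induction n with
    | zero => simp
    | succ n ih =>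
      intro t ht
      calc Φ (ρ ^ (n + 1) * t) = Φ (ρ * (ρ ^ n * t)) := by ring_nf
        _ ≤ ρ / 2 * Φ (ρ ^ n * t) := hcon _ (by positivity)
        _ ≤ ρ / 2 * ((ρ / 2) ^ n * Φ t) := by gcongr; exact ih t ht
        _ = _ := by ring
  refine ⟨p, (ρ / 2)⁻¹, hp1, (one_le_inv₀ (by positivity)).2 (by linarith), ?_⟩
  intro s hs hs1 t ht
  obtain ⟨n, hn1, hn2⟩ := exists_nat_pow_near_of_lt_one hs hs1 hρ hρ1
  calc Φ (s * t) ≤ Φ (ρ ^ n * t) :=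
        h.growth.monotoneOn (mem_Ici.2 (by positivity)) (mem_Ici.2 (by positivity))
          (by gcongr)
    _ ≤ (ρ / 2) ^ n * Φ t := hiter n t ht
    _ = (ρ / 2)⁻¹ * (ρ ^ (n + 1)) ^ p * Φ t := by
        rw [← Real.rpow_natCast ρ (n + 1), ← Real.rpow_mul hρ.le, mul_comm _ p,
          Real.rpow_mul hρ.le, hp, Real.rpow_natCast, pow_succ]
        field_simp
    _ ≤ _ := by
        have := h.growth.nonneg ht
        gcongr

/-- The two-sided type condition in the form used for dilations: if the mass of a function is
multiplied by `a⁻ᵇ`, then its modular stays bounded after division by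
`C (a ^ (-b/p) + a ^ (-b/q))`. -/
lemma ClassU.exists_dilation_bound (h : ClassU Φ) (hΨ : Delta2 (complementary Φ)) :
    ∃ p q C : ℝ, 1 < p ∧ 1 < q ∧ 0 < C ∧ ∀ a : ℝ, 0 < a → ∀ b : ℝ, 0 < b → ∀ x : ℝ≥0∞,
      ENNReal.ofReal (a ^ (-b)) *
        extPhi Φ (x / ENNReal.ofReal (C * (a ^ (-(b / p)) + a ^ (-(b / q))))) ≤ extPhi Φ x := by
  obtain ⟨p, C₁, hp, hC₁, hlow⟩ := h.exists_lowerType hΨ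
  obtain ⟨q₀, hq₀, C₂, hC₂, hup⟩ := h.upperType
  set q := q₀ + 1
  have hq : 1 < q := by simp only [q]; linarith
  set C := max C₁ C₂
  have hC : 1 ≤ C := hC₁.trans (le_max_left _ _)
  have hC0 : 0 < C := by linarith
  refine ⟨p, q, C, hp, hq, hC0, fun a ha b hb x => ?_⟩
  have main : ∀ d : ℝ, 0 < d → (∀ t, 0 ≤ t → Φ (d * t) ≤ C * a ^ b * Φ t) →
      ENNReal.ofReal (a ^ (-b)) * extPhi Φ (x / ENNReal.ofReal (C * d⁻¹)) ≤ extPhi Φ x := by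
    intro d hd hΦd
    have e1 : x / ENNReal.ofReal (C * d⁻¹) = (ENNReal.ofReal d * x) / ENNReal.ofReal C := by
      rw [ENNReal.ofReal_mul hC0.le, ENNReal.ofReal_inv_of_pos hd, div_eq_mul_inv,
        div_eq_mul_inv, ENNReal.mul_inv (by simp [hC0]) (by simp), inv_inv]
      ring
    rw [e1]
    calc ENNReal.ofReal (a ^ (-b)) * extPhi Φ ((ENNReal.ofReal d * x) / ENNReal.ofReal C)
        ≤ ENNReal.ofReal (a ^ (-b)) *
          (ENNReal.ofReal (C * a ^ b) * extPhi Φ x / ENNReal.ofReal C) := by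
          gcongr
          refine (h.extPhi_div_le hC _).trans ?_
          gcongr
          exact extPhi_le_of_forall hd (by positivity) hΦd x
      _ = ENNReal.ofReal (a ^ (-b) * (C * a ^ b) * C⁻¹) * extPhi Φ x := by
          rw [ENNReal.ofReal_mul (p := a ^ (-b) * (C * a ^ b)) (by positivity),
            ENNReal.ofReal_mul (p := a ^ (-b)) (by positivity),
            ENNReal.ofReal_inv_of_pos hC0, div_eq_mul_inv]
          ring
      _ = extPhi Φ x := by
          rw [Real.rpow_neg ha.le]
          have : (a ^ b)⁻¹ * (C * a ^ b) * C⁻¹ = 1 := by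
            have := Real.rpow_pos_of_pos ha b
            field_simp
          rw [this]; simp
  have hmono : ∀ d : ℝ, 0 < d → d⁻¹ ≤ a ^ (-(b / p)) + a ^ (-(b / q)) →
      extPhi Φ (x / ENNReal.ofReal (C * (a ^ (-(b / p)) + a ^ (-(b / q))))) ≤
        extPhi Φ (x / ENNReal.ofReal (C * d⁻¹)) := by
    intro d hd hle
    apply h.growth.extPhi_mono
    gcongr
  have hpp := Real.rpow_pos_of_pos ha (-(b / p))
  have hqq := Real.rpow_pos_of_pos ha (-(b / q))
  rcases le_total a 1 with ha1 | ha1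
  · have hd : 0 < a ^ (b / p) := by positivity
    refine (mul_le_mul_right (hmono (a ^ (b / p)) hd ?_) _).trans (main _ hd fun t ht => ?_)
    · rw [← Real.rpow_neg ha.le]; linarith
    · refine (hlow _ hd (Real.rpow_le_one ha.le ha1 (by positivity)) t ht).trans ?_
      rw [← Real.rpow_mul ha.le, div_mul_cancel₀ _ (by linarith)]
      have := h.growth.nonneg ht
      gcongr
      exact le_max_left _ _
  · have hd : 0 < a ^ (b / q) := by positivity
    have hd1 : 1 ≤ a ^ (b / q) := Real.one_le_rpow ha1 (by positivity)
    refine (mul_le_mul_right (hmono (a ^ (b / q)) hd ?_) _).trans (main _ hd fun t ht => ?_)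
    · rw [← Real.rpow_neg ha.le]; linarith
    · rw [mul_comm _ t]
      refine (hup _ hd1 t ht).trans ?_
      have := h.growth.nonneg ht
      have e : (a ^ (b / q)) ^ q = a ^ b := by
        rw [← Real.rpow_mul ha.le, div_mul_cancel₀ _ (by linarith)]
      have : (a ^ (b / q)) ^ q₀ ≤ a ^ b := by
        rw [← e]; exact Real.rpow_le_rpow_of_exponent_le hd1 (by simp only [q]; linarith)
      gcongr
      exact le_max_right _ _

end Growth

/-! ### The measure `y ^ α dx dy` and its dilations -/

lemma isOpen_upperHalf : IsOpen upperHalf := isOpen_lt continuous_const Complex.continuous_im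

lemma measurableSet_upperHalf : MeasurableSet upperHalf := isOpen_upperHalf.measurableSet

instance (α : ℝ) : SFinite (weightedVolume α) := by
  unfold weightedVolume; infer_instance

lemma measurable_weight (α : ℝ) : Measurable fun z : ℂ => ENNReal.ofReal (z.im ^ α) := by
  fun_prop

lemma ae_mem_upperHalf (α : ℝ) : ∀ᵐ z ∂(weightedVolume α), z ∈ upperHalf :=
  (withDensity_absolutelyContinuous _ _).ae_le (ae_restrict_mem measurableSet_upperHalf)

lemma weightedVolume_restrict (α : ℝ) :
    (weightedVolume α).restrict upperHalf = weightedVolume α :=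
  Measure.restrict_eq_self_of_ae_mem (ae_mem_upperHalf α)

lemma lintegral_weightedVolume (α : ℝ) {g : ℂ → ℝ≥0∞} (hg : Measurable g) :
    ∫⁻ z, g z ∂(weightedVolume α) =
      ∫⁻ z in upperHalf, ENNReal.ofReal (z.im ^ α) * g z := by
  rw [weightedVolume, lintegral_withDensity_eq_lintegral_mul _ (measurable_weight α) hg]
  rfl

lemma measurable_complex_mk {X : Type*} [MeasurableSpace X] {f g : X → ℝ} (hf : Measurable f)
    (hg : Measurable g) : Measurable fun x => (⟨f x, g x⟩ : ℂ) :=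
  Complex.measurableEquivRealProd.symm.measurable.comp (hf.prodMk hg)

/-- Integration against `y ^ α dx dy` as an iterated integral. -/
lemma lintegral_weightedVolume_eq_iterated (α : ℝ) {g : ℂ → ℝ≥0∞} (hg : Measurable g) :
    ∫⁻ z, g z ∂(weightedVolume α) =
      ∫⁻ y : ℝ in Ioi 0, ENNReal.ofReal (y ^ α) * ∫⁻ x : ℝ, g ⟨x, y⟩ := by
  have hind : Measurable (upperHalf.indicator fun z => ENNReal.ofReal (z.im ^ α) * g z) :=
    ((measurable_weight α).mul hg).indicator measurableSet_upperHalf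
  rw [lintegral_weightedVolume α hg, ← lintegral_indicator measurableSet_upperHalf,
    ← (Complex.volume_preserving_equiv_real_prod.symm).lintegral_comp hind,
    Measure.volume_eq_prod, lintegral_prod_symm, ← lintegral_indicator measurableSet_Ioi]
  · refine lintegral_congr fun y => ?_
    by_cases hy : 0 < y
    · have : ∀ x : ℝ, (⟨x, y⟩ : ℂ) ∈ upperHalf := fun x => hy
      have hm : Measurable fun x : ℝ => g ⟨x, y⟩ :=
        hg.comp (measurable_complex_mk measurable_id measurable_const)
      rw [indicator_of_mem (mem_Ioi.2 hy), ← lintegral_const_mul _ hm]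
      refine lintegral_congr fun x => ?_
      simp only [Complex.measurableEquivRealProd_symm_apply]
      rw [indicator_of_mem (this x)]
    · have : ∀ x : ℝ, (⟨x, y⟩ : ℂ) ∉ upperHalf := fun x => hy
      rw [indicator_of_notMem (by simpa using hy)]
      simp only [Complex.measurableEquivRealProd_symm_apply]
      simp [this]
  · refine Measurable.aemeasurable ?_
    exact hind.comp Complex.measurableEquivRealProd.symm.measurable

lemma lintegral_comp_mul_add {p : ℝ} (hp : 0 < p) (b : ℝ) {f : ℝ → ℝ≥0∞} (hf : Measurable f) :
    ∫⁻ x, f (p * x + b) = ENNReal.ofReal p⁻¹ * ∫⁻ x, f x := by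
  have h1 : ∫⁻ x, f (p * x + b) = ∫⁻ x, f (x + b) ∂(Measure.map (p * ·) volume) :=
    (lintegral_map (f := fun x => f (x + b)) (by fun_prop) (by fun_prop)).symm
  rw [h1, Real.map_volume_mul_left hp.ne', lintegral_smul_measure,
    lintegral_add_right_eq_self f b, abs_of_pos (by positivity), smul_eq_mul]

/-- The behaviour of `y ^ α dx dy` under the affine maps of `ℂ₊` preserving horizontal lines. -/
lemma lintegral_comp_affine (α : ℝ) {g : ℂ → ℝ≥0∞} (hg : Measurable g) (x₀ s : ℝ) {p c : ℝ}
    (hp : 0 < p) (hc : 0 < c) :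
    ∫⁻ z, g ⟨p * z.re + (s * z.im + x₀), c * z.im⟩ ∂(weightedVolume α) =
      ENNReal.ofReal (c ^ (-(α + 1)) * p⁻¹) * ∫⁻ z, g z ∂(weightedVolume α) := by
  have hm2 : Measurable fun z : ℂ => (⟨p * z.re + (s * z.im + x₀), c * z.im⟩ : ℂ) :=
    measurable_complex_mk (by fun_prop) (by fun_prop)
  have hm3 : Measurable fun z : ℂ => g ⟨p * z.re + (s * z.im + x₀), c * z.im⟩ := hg.comp hm2
  rw [lintegral_weightedVolume_eq_iterated α hg, lintegral_weightedVolume_eq_iterated α hm3]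
  have hG : Measurable fun y : ℝ => ∫⁻ x : ℝ, g ⟨x, y⟩ := by
    refine Measurable.lintegral_prod_right' (f := fun q : ℝ × ℝ => g ⟨q.2, q.1⟩) ?_
    exact hg.comp (Complex.measurableEquivRealProd.symm.measurable.comp measurable_swap)
  set G := fun y : ℝ => ∫⁻ x : ℝ, g ⟨x, y⟩ with hGdef
  have hH : Measurable ((Ioi (0 : ℝ)).indicator fun y => ENNReal.ofReal (y ^ α) * G y) :=
    Measurable.indicator (by fun_prop) measurableSet_Ioi
  have inner : ∀ y : ℝ, ∫⁻ x : ℝ, g ⟨p * x + (s * y + x₀), c * y⟩ =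
      ENNReal.ofReal p⁻¹ * G (c * y) := fun y =>
    lintegral_comp_mul_add hp (s * y + x₀) 
      (hg.comp (measurable_complex_mk measurable_id measurable_const))
  simp only [inner]
  rw [← lintegral_indicator measurableSet_Ioi, ← lintegral_indicator measurableSet_Ioi]
  have e : ∀ y : ℝ, (Ioi (0 : ℝ)).indicator
      (fun y => ENNReal.ofReal (y ^ α) * (ENNReal.ofReal p⁻¹ * G (c * y))) y =
      ENNReal.ofReal (p⁻¹ * c ^ (-α)) *
        (Ioi (0 : ℝ)).indicator (fun y => ENNReal.ofReal (y ^ α) * G y) (c * y + 0) := by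
    intro y
    by_cases hy : 0 < y
    · have hcy : 0 < c * y := by positivity
      rw [indicator_of_mem (mem_Ioi.2 hy), add_zero, indicator_of_mem (mem_Ioi.2 hcy)]
      have : y ^ α = c ^ (-α) * (c * y) ^ α := by
        rw [Real.mul_rpow hc.le hy.le, ← mul_assoc, ← Real.rpow_add hc]; simp
      rw [this, ENNReal.ofReal_mul (by positivity), ENNReal.ofReal_mul (by positivity)]
      ring
    · have hcy : ¬ 0 < c * y := fun h => hy (pos_of_mul_pos_right h hc.le)
      rw [indicator_of_notMem (by simpa using hy), add_zero,
        indicator_of_notMem (by simpa using hcy), mul_zero]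
  simp only [e]
  rw [lintegral_const_mul _ (by fun_prop), lintegral_comp_mul_add hc 0 hH, ← mul_assoc,
    ← ENNReal.ofReal_mul (by positivity)]
  congr 2
  rw [neg_add, Real.rpow_add hc, Real.rpow_neg_one]
  ring

/-- The affine automorphism `w ↦ x + y w` of `ℂ₊` attached to the point `x + i y`. -/
def halfPlaneAct (z w : ℂ) : ℂ := ⟨z.im * w.re + z.re, z.im * w.im⟩

lemma halfPlaneAct_eq (z w : ℂ) : halfPlaneAct z w = z.re + z.im * w := by
  apply Complex.ext <;> simp [halfPlaneAct, add_comm]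

lemma halfPlaneAct_mem {z w : ℂ} (hz : z ∈ upperHalf) (hw : w ∈ upperHalf) :
    halfPlaneAct z w ∈ upperHalf :=
  mul_pos (a := z.im) (b := w.im) hz hw

lemma measurable_halfPlaneAct : Measurable fun q : ℂ × ℂ => halfPlaneAct q.1 q.2 :=
  measurable_complex_mk (by fun_prop) (by fun_prop)

/-- `y ^ α dx dy` is relatively invariant under left translations of the affine group. -/
lemma lintegral_halfPlaneAct_left (α : ℝ) {g : ℂ → ℝ≥0∞} (hg : Measurable g) {z : ℂ}
    (hz : z ∈ upperHalf) :
    ∫⁻ w, g (halfPlaneAct z w) ∂(weightedVolume α) =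
      ENNReal.ofReal (z.im ^ (-(α + 2))) * ∫⁻ w, g w ∂(weightedVolume α) := by
  have hz' : 0 < z.im := hz
  have := lintegral_comp_affine α hg z.re 0 hz' hz'
  simp only [zero_mul, zero_add] at this
  simp only [halfPlaneAct, this]
  congr 2
  rw [← Real.rpow_neg_one z.im, ← Real.rpow_add hz']
  congr 1; ring

/-- `y ^ α dx dy` is relatively invariant under right translations of the affine group, with an
exponent different from that of the left translations. -/
lemma lintegral_halfPlaneAct_right (α : ℝ) {g : ℂ → ℝ≥0∞} (hg : Measurable g) {w : ℂ}
    (hw : w ∈ upperHalf) :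
    ∫⁻ z, g (halfPlaneAct z w) ∂(weightedVolume α) =
      ENNReal.ofReal (w.im ^ (-(α + 1))) * ∫⁻ z, g z ∂(weightedVolume α) := by
  have hw' : 0 < w.im := hw
  have := lintegral_comp_affine α hg 0 w.re one_pos hw'
  simp only [one_mul, add_zero, inv_one, mul_one] at this
  rw [← this]
  refine lintegral_congr fun z => ?_
  congr 1
  apply Complex.ext <;> simp [halfPlaneAct] <;> ring

lemma map_halfPlaneAct (α : ℝ) {z : ℂ} (hz : z ∈ upperHalf) :
    Measure.map (halfPlaneAct z) (weightedVolume α) =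
      ENNReal.ofReal (z.im ^ (-(α + 2))) • weightedVolume α := by
  have hm : Measurable (halfPlaneAct z) := measurable_halfPlaneAct.comp measurable_prodMk_left
  ext s hs
  rw [← lintegral_indicator_one hs, lintegral_map (measurable_one.indicator hs) hm,
    lintegral_halfPlaneAct_left α (measurable_one.indicator hs) hz, lintegral_indicator_one hs]
  simp

/-! ### The positive Bergman operator -/

/-- The modulus `|z - conj w| ^ (-α - 2)` of the Bergman kernel. -/
def absKernel (α : ℝ) (z w : ℂ) : ℝ := ‖z - (starRingEnd ℂ) w‖ ^ (-(α + 2))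

/-- The integral operator on `L^Φ(y ^ α dx dy)` with the positive kernel
`|z - conj w| ^ (-α - 2)`. -/
def posOp (α : ℝ) (g : ℂ → ℝ≥0∞) (z : ℂ) : ℝ≥0∞ :=
  ∫⁻ w, ENNReal.ofReal (absKernel α z w) * g w ∂(weightedVolume α)

lemma measurable_absKernel (α : ℝ) : Measurable fun q : ℂ × ℂ => absKernel α q.1 q.2 := by
  unfold absKernel
  fun_prop

lemma measurable_posOp (α : ℝ) {g : ℂ → ℝ≥0∞} (hg : Measurable g) : Measurable (posOp α g) := by
  refine Measurable.lintegral_prod_right'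
    (f := fun q : ℂ × ℂ => ENNReal.ofReal (absKernel α q.1 q.2) * g q.2) ?_
  exact ((measurable_absKernel α).ennreal_ofReal).mul (hg.comp measurable_snd)

lemma posOp_const_mul (α : ℝ) {g : ℂ → ℝ≥0∞} (hg : Measurable g) (c : ℝ≥0∞) (z : ℂ) :
    posOp α (fun w => c * g w) z = c * posOp α g z := by
  have hm : Measurable fun w => ENNReal.ofReal (absKernel α z w) * g w :=
    (((measurable_absKernel α).comp measurable_prodMk_left).ennreal_ofReal).mul hg
  rw [posOp, posOp, ← lintegral_const_mul _ hm]
  refine lintegral_congr fun w => ?_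
  ring

lemma im_le_norm_sub_conj (z w : ℂ) :
    z.im + w.im ≤ ‖z - (starRingEnd ℂ) w‖ := by
  have := Complex.abs_im_le_norm (z - (starRingEnd ℂ) w)
  simp only [Complex.sub_im, Complex.conj_im, sub_neg_eq_add] at this
  exact (le_abs_self _).trans this

lemma absKernel_halfPlaneAct (α : ℝ) {z : ℂ} (hz : z ∈ upperHalf) (w : ℂ) :
    absKernel α z (halfPlaneAct z w) = z.im ^ (-(α + 2)) * absKernel α Complex.I w := by
  have hz' : 0 < z.im := hz
  have e : z - (starRingEnd ℂ) (halfPlaneAct z w) =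
      (z.im : ℂ) * (Complex.I - (starRingEnd ℂ) w) := by
    apply Complex.ext <;> simp [halfPlaneAct]; ring
  rw [absKernel, absKernel, e, norm_mul, Real.mul_rpow (norm_nonneg _) (norm_nonneg _),
    Complex.norm_real, Real.norm_of_nonneg hz'.le]

/-- The positive Bergman operator is a superposition of the dilations `g ↦ g (x + y w)`. -/
lemma posOp_eq (α : ℝ) {g : ℂ → ℝ≥0∞} (hg : Measurable g) {z : ℂ} (hz : z ∈ upperHalf) :
    posOp α g z =
      ∫⁻ w, ENNReal.ofReal (absKernel α Complex.I w) * g (halfPlaneAct z w)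
        ∂(weightedVolume α) := by
  have hz' : 0 < z.im := hz
  have hm : Measurable fun w => ENNReal.ofReal (absKernel α z w) * g w :=
    (((measurable_absKernel α).comp measurable_prodMk_left).ennreal_ofReal).mul hg
  have h1 := lintegral_halfPlaneAct_left α hm hz
  have h2 : ENNReal.ofReal (z.im ^ (-(α + 2))) ≠ 0 := by
    simpa using Real.rpow_pos_of_pos hz' _
  have hact : Measurable (halfPlaneAct z) := measurable_halfPlaneAct.comp measurable_prodMk_left
  have h3 : Measurable fun w => ENNReal.ofReal (absKernel α Complex.I w) * g (halfPlaneAct z w) :=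
    (((measurable_absKernel α).comp measurable_prodMk_left).ennreal_ofReal).mul (hg.comp hact)
  rw [← ENNReal.mul_right_inj h2 ENNReal.ofReal_ne_top, posOp, ← h1, ← lintegral_const_mul _ h3]
  refine lintegral_congr fun w => ?_
  rw [absKernel_halfPlaneAct α hz, ENNReal.ofReal_mul (by positivity), mul_assoc]

/-- A Forelli–Rudin estimate at the base point `i`. -/
lemma lintegral_absKernel_rpow_lt_top {α σ : ℝ} (hσ : 0 < σ) (hσα : σ < α + 1) :
    ∫⁻ w, ENNReal.ofReal (absKernel α Complex.I w) * ENNReal.ofReal (w.im ^ (-σ))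
      ∂(weightedVolume α) < ∞ := by
  have hm : Measurable fun w : ℂ =>
      ENNReal.ofReal (absKernel α Complex.I w) * ENNReal.ofReal (w.im ^ (-σ)) :=
    (((measurable_absKernel α).comp measurable_prodMk_left).ennreal_ofReal).mul (by fun_prop)
  rw [lintegral_weightedVolume_eq_iterated α hm]
  -- Split `|s + i (1 + a)| ≥ max(1 + a, √(1 + s²))` with exponents `α + 1 - σ / 2`, `1 + σ / 2`.
  set A : ℝ≥0∞ := ∫⁻ s : ℝ, ENNReal.ofReal ((1 + ‖s‖ ^ 2) ^ (-(1 + σ / 2) / 2)) with hA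
  have hAfin : A < ∞ := by
    have := (integrable_rpow_neg_one_add_norm_sq (E := ℝ) (μ := volume) (r := 1 + σ / 2)
      (by simp; linarith)).lintegral_lt_top
    simpa [hA] using this
  have hbound : ∀ a : ℝ, 0 < a → ∀ s : ℝ,
      absKernel α Complex.I ⟨s, a⟩ ≤
        (1 + a) ^ (-(α + 1 - σ / 2)) * (1 + ‖s‖ ^ 2) ^ (-(1 + σ / 2) / 2) := by
    intro a ha s
    have hn : ‖Complex.I - (starRingEnd ℂ) ⟨s, a⟩‖ = Real.sqrt (s ^ 2 + (1 + a) ^ 2) := by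
      rw [Complex.norm_def, Complex.normSq_apply]
      congr 1
      simp
      ring
    have h1 : 1 + a ≤ Real.sqrt (s ^ 2 + (1 + a) ^ 2) :=
      Real.le_sqrt_of_sq_le (by nlinarith)
    have h2 : Real.sqrt (1 + ‖s‖ ^ 2) ≤ Real.sqrt (s ^ 2 + (1 + a) ^ 2) := by
      apply Real.sqrt_le_sqrt
      rw [Real.norm_eq_abs, sq_abs]; nlinarith
    have h0 : 0 < Real.sqrt (s ^ 2 + (1 + a) ^ 2) := by linarith
    rw [absKernel, hn]
    have e : -(α + 2) = -(α + 1 - σ / 2) + -(1 + σ / 2) := by ring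
    have e2 : (1 + ‖s‖ ^ 2) ^ (-(1 + σ / 2) / 2) = Real.sqrt (1 + ‖s‖ ^ 2) ^ (-(1 + σ / 2)) := by
      rw [Real.sqrt_eq_rpow, ← Real.rpow_mul (by positivity)]
      congr 1; ring
    rw [e, Real.rpow_add h0, e2]
    gcongr ?_ * ?_
    · exact Real.rpow_le_rpow_of_nonpos (by linarith) h1 (by linarith)
    · exact Real.rpow_le_rpow_of_nonpos (by positivity) h2 (by linarith)
  have hstep : ∀ a ∈ Ioi (0 : ℝ), ENNReal.ofReal (a ^ α) * ∫⁻ s : ℝ,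
      ENNReal.ofReal (absKernel α Complex.I ⟨s, a⟩) * ENNReal.ofReal ((⟨s, a⟩ : ℂ).im ^ (-σ)) ≤
      A * ENNReal.ofReal (a ^ (α - σ) * (1 + a) ^ (-(α + 1 - σ / 2))) := by
    intro a ha
    have ha' : 0 < a := ha
    calc _ ≤ ENNReal.ofReal (a ^ α) * ∫⁻ s : ℝ, ENNReal.ofReal ((1 + ‖s‖ ^ 2) ^
            (-(1 + σ / 2) / 2)) * ENNReal.ofReal ((1 + a) ^ (-(α + 1 - σ / 2)) * a ^ (-σ)) := by
          refine mul_le_mul_right (lintegral_mono fun s => ?_) _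
          simp only
          rw [← ENNReal.ofReal_mul (p := absKernel _ _ _) (Real.rpow_nonneg (norm_nonneg _) _),
            ← ENNReal.ofReal_mul (by positivity)]
          apply ENNReal.ofReal_le_ofReal
          have := mul_le_mul_of_nonneg_right (hbound a ha' s)
            (Real.rpow_nonneg ha'.le (-σ))
          linarith
      _ = _ := by
          rw [lintegral_mul_const _ (by fun_prop), mul_left_comm,
            ← ENNReal.ofReal_mul (by positivity)]
          congr 2
          rw [sub_eq_add_neg α σ, Real.rpow_add ha']
          ring
  refine (setLIntegral_mono' measurableSet_Ioi hstep).trans_lt ?_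
  rw [lintegral_const_mul _ (by fun_prop)]
  refine ENNReal.mul_lt_top hAfin ?_
  rw [← Ioc_union_Ioi_eq_Ioi zero_le_one]
  refine (lintegral_union_le _ _ _).trans_lt (ENNReal.add_lt_top.2 ⟨?_, ?_⟩)
  · have hint : IntegrableOn (fun a : ℝ => a ^ (α - σ)) (Ioc 0 1) :=
      (intervalIntegrable_iff_integrableOn_Ioc_of_le zero_le_one).1
        (intervalIntegral.intervalIntegrable_rpow' (by linarith))
    refine lt_of_le_of_lt (setLIntegral_mono' measurableSet_Ioc fun a ha => ?_)
      hint.lintegral_lt_top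
    apply ENNReal.ofReal_le_ofReal
    have ha0 : 0 < a := ha.1
    refine mul_le_of_le_one_right (by positivity) ?_
    exact Real.rpow_le_one_of_one_le_of_nonpos (by linarith) (by linarith)
  · have hint : IntegrableOn (fun a : ℝ => a ^ (-1 - σ / 2)) (Ioi 1) :=
      integrableOn_Ioi_rpow_of_lt (by linarith) one_pos
    refine lt_of_le_of_lt (setLIntegral_mono' measurableSet_Ioi fun a ha => ?_)
      hint.lintegral_lt_top
    apply ENNReal.ofReal_le_ofReal
    have ha0 : 0 < a := zero_lt_one.trans ha
    have : -1 - σ / 2 = (α - σ) + -(α + 1 - σ / 2) := by ring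
    rw [this, Real.rpow_add ha0]
    gcongr ?_ * ?_
    exact Real.rpow_le_rpow_of_nonpos ha0 (by linarith) (by linarith)

/-- The modular form of the boundedness of the positive Bergman operator on `L^Φ`: Jensen's
inequality, applied to the representation of the operator as a superposition of dilations, with
each dilation divided by a bound for its norm. -/
lemma ClassU.modular_posOp_le {Φ : ℝ → ℝ} (h : ClassU Φ) (hΨ : Delta2 (complementary Φ)) {α : ℝ}
    (hα : -1 < α) :
    ∃ M : ℝ, 0 < M ∧ ∀ g : ℂ → ℝ≥0∞, Measurable g →
      ∫⁻ z, extPhi Φ (posOp α g z / ENNReal.ofReal M) ∂(weightedVolume α) ≤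
        ∫⁻ z, extPhi Φ (g z) ∂(weightedVolume α) := by
  obtain ⟨p, q, C, hp, hq, hC, hdil⟩ := h.exists_dilation_bound hΨ
  have hb : 0 < α + 1 := by linarith
  set N : ℂ → ℝ := fun w => C * (w.im ^ (-((α + 1) / p)) + w.im ^ (-((α + 1) / q)))
  have hNm : Measurable fun w => ENNReal.ofReal (N w) := by simp only [N]; fun_prop
  have hκm : Measurable fun w => ENNReal.ofReal (absKernel α Complex.I w) :=
    ((measurable_absKernel α).comp measurable_prodMk_left).ennreal_ofReal
  have hNpos : ∀ w ∈ upperHalf, 0 < N w := fun w hw => by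
    have : 0 < w.im := hw
    positivity
  have hfin : ∫⁻ w, ENNReal.ofReal (absKernel α Complex.I w) * ENNReal.ofReal (N w)
      ∂(weightedVolume α) < ∞ := by
    have e : ∀ w ∈ upperHalf, ENNReal.ofReal (absKernel α Complex.I w) * ENNReal.ofReal (N w) =
        ENNReal.ofReal C * (ENNReal.ofReal (absKernel α Complex.I w) *
          ENNReal.ofReal (w.im ^ (-((α + 1) / p)))) +
        ENNReal.ofReal C * (ENNReal.ofReal (absKernel α Complex.I w) *
          ENNReal.ofReal (w.im ^ (-((α + 1) / q)))) := by
      intro w hw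
      have : 0 < w.im := hw
      simp only [N]
      rw [ENNReal.ofReal_mul hC.le, ENNReal.ofReal_add (by positivity) (by positivity)]
      ring
    have hmr : ∀ r : ℝ, Measurable fun w : ℂ =>
        ENNReal.ofReal (absKernel α Complex.I w) * ENNReal.ofReal (w.im ^ r) := fun r =>
      hκm.mul (by fun_prop)
    rw [lintegral_congr_ae ((ae_mem_upperHalf α).mono e),
      lintegral_add_left ((hmr _).const_mul _), lintegral_const_mul _ (hmr _),
      lintegral_const_mul _ (hmr _)]
    refine ENNReal.add_lt_top.2 ⟨ENNReal.mul_lt_top ENNReal.ofReal_lt_top ?_,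
      ENNReal.mul_lt_top ENNReal.ofReal_lt_top ?_⟩
    · exact lintegral_absKernel_rpow_lt_top (by positivity) (div_lt_self hb hp)
    · exact lintegral_absKernel_rpow_lt_top (by positivity) (div_lt_self hb hq)
  set I := ∫⁻ w, ENNReal.ofReal (absKernel α Complex.I w) * ENNReal.ofReal (N w)
      ∂(weightedVolume α)
  set M : ℝ := I.toReal + 1
  have hM : 0 < M := by positivity
  have hIM : I / ENNReal.ofReal M ≤ 1 := by
    apply ENNReal.div_le_of_le_mul
    rw [one_mul, ← ENNReal.ofReal_toReal hfin.ne]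
    exact ENNReal.ofReal_le_ofReal (by simp [M])
  set ν := (weightedVolume α).withDensity fun w =>
    ENNReal.ofReal (absKernel α Complex.I w) * ENNReal.ofReal (N w) / ENNReal.ofReal M with hν
  have hκN : Measurable fun w =>
      ENNReal.ofReal (absKernel α Complex.I w) * ENNReal.ofReal (N w) := hκm.mul hNm
  have hdm : Measurable fun w => ENNReal.ofReal (absKernel α Complex.I w) * ENNReal.ofReal (N w) /
      ENNReal.ofReal M := hκN.div_const _
  have hν1 : ν univ ≤ 1 := by
    rw [hν, withDensity_apply _ MeasurableSet.univ, Measure.restrict_univ]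
    simp only [div_eq_mul_inv] at hIM ⊢
    rwa [lintegral_mul_const _ hκN]
  have hνae : ∀ᵐ w ∂ν, w ∈ upperHalf :=
    (withDensity_absolutelyContinuous _ _).ae_le (ae_mem_upperHalf α)
  refine ⟨M, hM, fun g hg => ?_⟩
  have hext := h.growth.measurable_extPhi
  have hpt : ∀ z ∈ upperHalf, extPhi Φ (posOp α g z / ENNReal.ofReal M) ≤
      ∫⁻ w, extPhi Φ (g (halfPlaneAct z w) / ENNReal.ofReal (N w)) ∂ν := by
    intro z hz
    have hgz : Measurable fun w => g (halfPlaneAct z w) :=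
      hg.comp (measurable_halfPlaneAct.comp measurable_prodMk_left)
    have hq' : Measurable fun w => g (halfPlaneAct z w) / ENNReal.ofReal (N w) := hgz.div hNm
    have hκg : Measurable fun w =>
        ENNReal.ofReal (absKernel α Complex.I w) * g (halfPlaneAct z w) := hκm.mul hgz
    have e : posOp α g z / ENNReal.ofReal M =
        ∫⁻ w, g (halfPlaneAct z w) / ENNReal.ofReal (N w) ∂ν := by
      rw [posOp_eq α hg hz, hν, lintegral_withDensity_eq_lintegral_mul _ hdm hq', div_eq_mul_inv, ← lintegral_mul_const _ hκg]
      refine lintegral_congr_ae ((ae_mem_upperHalf α).mono fun w hw => ?_)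
      have h1 : ENNReal.ofReal (N w) ≠ 0 := by simpa using hNpos w hw
      simp only [Pi.mul_apply, div_eq_mul_inv]
      calc _ = ENNReal.ofReal (absKernel α Complex.I w) * g (halfPlaneAct z w) *
            (ENNReal.ofReal M)⁻¹ * (ENNReal.ofReal (N w) * (ENNReal.ofReal (N w))⁻¹) := by
            rw [ENNReal.mul_inv_cancel h1 ENNReal.ofReal_ne_top, mul_one]
        _ = _ := by ring
    rw [e]
    exact h.jensen ν hν1 hq'
  calc ∫⁻ z, extPhi Φ (posOp α g z / ENNReal.ofReal M) ∂(weightedVolume α)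
      ≤ ∫⁻ z, ∫⁻ w, extPhi Φ (g (halfPlaneAct z w) / ENNReal.ofReal (N w)) ∂ν
          ∂(weightedVolume α) := lintegral_mono_ae ((ae_mem_upperHalf α).mono hpt)
    _ = ∫⁻ w, ∫⁻ z, extPhi Φ (g (halfPlaneAct z w) / ENNReal.ofReal (N w)) ∂(weightedVolume α)
          ∂ν := by
        refine lintegral_lintegral_swap (Measurable.aemeasurable ?_)
        exact hext.comp ((hg.comp measurable_halfPlaneAct).div (hNm.comp measurable_snd))
    _ ≤ ∫⁻ _, (∫⁻ z, extPhi Φ (g z) ∂(weightedVolume α)) ∂ν := by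
        refine lintegral_mono_ae (hνae.mono fun w hw => ?_)
        have hm1 : Measurable fun z => extPhi Φ (g z / ENNReal.ofReal (N w)) :=
          hext.comp (hg.div_const _)
        have hw' : 0 < w.im := hw
        rw [lintegral_halfPlaneAct_right α hm1 hw, ← lintegral_const_mul _ hm1]
        exact lintegral_mono fun z => hdil w.im hw' (α + 1) hb (g z)
    _ ≤ _ := by
        rw [lintegral_const]
        exact mul_le_of_le_one_right' hν1

/-! ### Estimates for the Bergman kernel -/

lemma norm_kernel (α : ℝ) (z w : ℂ) : ‖kernel α z w‖ = absKernel α z w := by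
  rw [kernel, Complex.norm_cpow_real, absKernel, norm_div, Complex.norm_I, div_one]
  congr 1; ring

lemma re_kernel_base (z w : ℂ) : ((z - (starRingEnd ℂ) w) / Complex.I).re = z.im + w.im := by
  simp

lemma norm_sub_conj_pos {z w : ℂ} (hz : z ∈ upperHalf) (hw : w ∈ upperHalf) :
    0 < ‖z - (starRingEnd ℂ) w‖ := by
  have h1 : 0 < z.im := hz
  have h2 : 0 < w.im := hw
  linarith [im_le_norm_sub_conj z w]

lemma absKernel_nonneg (α : ℝ) (z w : ℂ) : 0 ≤ absKernel α z w := Real.rpow_nonneg (norm_nonneg _) _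

lemma absKernel_pos (α : ℝ) {z w : ℂ} (hz : z ∈ upperHalf) (hw : w ∈ upperHalf) :
    0 < absKernel α z w := Real.rpow_pos_of_pos (norm_sub_conj_pos hz hw) _

lemma absKernel_comm (α : ℝ) (z w : ℂ) : absKernel α z w = absKernel α w z := by
  rw [absKernel, absKernel]
  congr 1
  rw [← Complex.norm_conj, map_sub, Complex.conj_conj, norm_sub_rev]

lemma kernel_ne_zero (α : ℝ) {z w : ℂ} (hz : z ∈ upperHalf) (hw : w ∈ upperHalf) :
    kernel α z w ≠ 0 := by
  rw [← norm_pos_iff, norm_kernel]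
  exact absKernel_pos α hz hw

lemma kernel_conj (α : ℝ) {z w : ℂ} (hz : z ∈ upperHalf) (hw : w ∈ upperHalf) :
    kernel α z w = (starRingEnd ℂ) (kernel α w z) := by
  have h1 : 0 < z.im := hz
  have h2 : 0 < w.im := hw
  have harg : ((w - (starRingEnd ℂ) z) / Complex.I).arg ≠ Real.pi := by
    intro h
    have := (Complex.arg_eq_pi_iff.1 h).1
    rw [re_kernel_base] at this
    linarith
  have e : (z - (starRingEnd ℂ) w) / Complex.I =
      (starRingEnd ℂ) ((w - (starRingEnd ℂ) z) / Complex.I) := by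
    apply Complex.ext <;> simp [add_comm]
  rw [kernel, kernel, e, Complex.conj_cpow _ _ harg, Complex.conj_ofReal]

lemma kernel_halfPlaneAct (α : ℝ) {z w : ℂ} (hz : z ∈ upperHalf) (hw : w ∈ upperHalf) :
    kernel α z (halfPlaneAct z w) =
      ((z.im ^ (-(α + 2)) : ℝ) : ℂ) * kernel α Complex.I w := by
  have h1 : 0 < z.im := hz
  have h2 : 0 < w.im := hw
  have e : (z - (starRingEnd ℂ) (halfPlaneAct z w)) / Complex.I =
      (z.im : ℂ) * ((Complex.I - (starRingEnd ℂ) w) / Complex.I) := by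
    apply Complex.ext
    · simp [halfPlaneAct]; ring
    · simp [halfPlaneAct]
  have hb : (Complex.I - (starRingEnd ℂ) w) / Complex.I ≠ 0 := by
    intro h
    have := re_kernel_base Complex.I w
    rw [h] at this
    simp at this
    linarith
  have hz0 : (z.im : ℂ) ≠ 0 := by exact_mod_cast h1.ne'
  rw [kernel, kernel, e, Complex.cpow_def_of_ne_zero (mul_ne_zero hz0 hb),
    Complex.log_ofReal_mul h1 hb, add_mul, Complex.exp_add, ← Complex.cpow_def_of_ne_zero hb,
    Complex.ofReal_log h1.le, ← Complex.cpow_def_of_ne_zero hz0, Complex.ofReal_cpow h1.le]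
  congr 3
  ring

lemma absKernel_le_of_norm_le {α : ℝ} (hα : -1 < α) {z w z' w' : ℂ} (hz : z ∈ upperHalf)
    (hw : w ∈ upperHalf)
    (h : ‖z - (starRingEnd ℂ) w‖ ≤ 2 * ‖z' - (starRingEnd ℂ) w'‖) :
    absKernel α z' w' ≤ 2 ^ (α + 2) * absKernel α z w := by
  have h1 := norm_sub_conj_pos hz hw
  have e : (2 : ℝ) ^ (α + 2) * absKernel α z w = (‖z - (starRingEnd ℂ) w‖ / 2) ^ (-(α + 2)) := by
    rw [Real.div_rpow h1.le (by norm_num), absKernel, Real.rpow_neg (by norm_num : (0:ℝ) ≤ 2)]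
    field_simp
  rw [e, absKernel]
  exact Real.rpow_le_rpow_of_nonpos (by positivity) (by linarith) (by linarith)

/-- Harnack's inequality for the kernel in the first variable. -/
lemma absKernel_le_left {α : ℝ} (hα : -1 < α) {z w z' : ℂ} (hz : z ∈ upperHalf)
    (hw : w ∈ upperHalf) (h : ‖z - z'‖ ≤ z.im / 2) :
    absKernel α z' w ≤ 2 ^ (α + 2) * absKernel α z w := by
  refine absKernel_le_of_norm_le hα hz hw ?_
  have h1 := im_le_norm_sub_conj z w
  have h2 : 0 < w.im := hw
  have h3 := norm_add_le (z - z') (z' - (starRingEnd ℂ) w)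
  rw [sub_add_sub_cancel] at h3
  linarith

lemma absKernel_le_right {α : ℝ} (hα : -1 < α) {z w w' : ℂ} (hz : z ∈ upperHalf)
    (hw : w ∈ upperHalf) (h : ‖w - w'‖ ≤ w.im / 2) :
    absKernel α z w' ≤ 2 ^ (α + 2) * absKernel α z w := by
  rw [absKernel_comm α z w', absKernel_comm α z w]
  exact absKernel_le_left hα hw hz h

/-- The constant of the Lipschitz estimate for the kernel. -/
def lipConst (α : ℝ) : ℝ := (α + 2) * 2 ^ (α + 3)

lemma lipConst_pos {α : ℝ} (hα : -1 < α) : 0 < lipConst α := by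
  have : 0 < α + 2 := by linarith
  unfold lipConst; positivity

lemma norm_cpow_sub_cpow_le {α : ℝ} (hα : -1 < α) {a b : ℂ} (ha : 0 < a.re) (hb : 0 < b.re)
    {ε : ℝ} (hε : ε ≤ 1 / 2) (hab : ‖a - b‖ ≤ ε * ‖a‖) :
    ‖a ^ ((-α - 2 : ℝ) : ℂ) - b ^ ((-α - 2 : ℝ) : ℂ)‖ ≤ lipConst α * ε * ‖a‖ ^ (-(α + 2)) := by
  have ha0 : 0 < ‖a‖ := norm_pos_iff.2 fun h => by simp [h] at ha
  set s : Set ℂ := {x | 0 < x.re} ∩ Metric.closedBall a (‖a‖ / 2)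
  have hconv : Convex ℝ s :=
    (convex_halfSpace_re_gt 0).inter (convex_closedBall _ _)
  have hsa : a ∈ s := ⟨ha, Metric.mem_closedBall_self (by positivity)⟩
  have hsb : b ∈ s := by
    refine ⟨hb, ?_⟩
    rw [Metric.mem_closedBall, dist_eq_norm, norm_sub_rev]
    nlinarith
  have hder : ∀ x ∈ s, HasDerivWithinAt (fun x : ℂ => x ^ ((-α - 2 : ℝ) : ℂ))
      (((-α - 2 : ℝ) : ℂ) * x ^ (((-α - 2 : ℝ) : ℂ) - 1)) s x := by
    intro x hx
    have := (hasDerivAt_id x).cpow_const (c := ((-α - 2 : ℝ) : ℂ)) (Or.inl hx.1)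
    simpa using this.hasDerivWithinAt
  have hbound : ∀ x ∈ s, ‖((-α - 2 : ℝ) : ℂ) * x ^ (((-α - 2 : ℝ) : ℂ) - 1)‖ ≤
      (α + 2) * (‖a‖ / 2) ^ (-(α + 3)) := by
    intro x hx
    have hxa : ‖a‖ / 2 ≤ ‖x‖ := by
      have h1 : ‖x - a‖ ≤ ‖a‖ / 2 := by simpa [dist_eq_norm] using hx.2
      have h2 := norm_sub_norm_le a x
      rw [norm_sub_rev] at h1
      linarith
    have e : (((-α - 2 : ℝ) : ℂ) - 1) = ((-(α + 3) : ℝ) : ℂ) := by push_cast; ring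
    rw [norm_mul, e, Complex.norm_cpow_real, Complex.norm_real, Real.norm_eq_abs,
      abs_of_neg (by linarith)]
    have := Real.rpow_le_rpow_of_nonpos (z := -(α + 3)) (by positivity) hxa (by linarith)
    have h2 : 0 < α + 2 := by linarith
    calc -(-α - 2) * ‖x‖ ^ (-(α + 3)) = (α + 2) * ‖x‖ ^ (-(α + 3)) := by ring
      _ ≤ _ := by gcongr
  have := hconv.norm_image_sub_le_of_norm_hasDerivWithin_le hder hbound hsb hsa
  refine this.trans ?_
  have e2 : (‖a‖ / 2) ^ (-(α + 3)) = 2 ^ (α + 3) * (‖a‖ ^ (-(α + 2)) / ‖a‖) := by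
    rw [Real.div_rpow ha0.le (by norm_num), Real.rpow_neg (by norm_num : (0 : ℝ) ≤ 2),
      ← Real.rpow_sub_one ha0.ne', div_inv_eq_mul, mul_comm]
    congr 2; ring
  have h2 : 0 < α + 2 := by linarith
  rw [e2]
  calc (α + 2) * (2 ^ (α + 3) * (‖a‖ ^ (-(α + 2)) / ‖a‖)) * ‖a - b‖
      ≤ (α + 2) * (2 ^ (α + 3) * (‖a‖ ^ (-(α + 2)) / ‖a‖)) * (ε * ‖a‖) := by gcongr
    _ = _ := by rw [lipConst]; field_simp

lemma norm_kernel_sub_le_right {α : ℝ} (hα : -1 < α) {z w w' : ℂ} (hz : z ∈ upperHalf)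
    (hw : w ∈ upperHalf) (hw' : w' ∈ upperHalf) {ε : ℝ} (hε : ε ≤ 1 / 2) (hε0 : 0 ≤ ε)
    (h : ‖w - w'‖ ≤ ε * w.im) :
    ‖kernel α z w - kernel α z w'‖ ≤ lipConst α * ε * absKernel α z w := by
  have h1 : 0 < z.im := hz
  have h2 : 0 < w.im := hw
  have h3 : 0 < w'.im := hw'
  have := norm_cpow_sub_cpow_le hα (a := (z - (starRingEnd ℂ) w) / Complex.I)
    (b := (z - (starRingEnd ℂ) w') / Complex.I) (by rw [re_kernel_base]; linarith)
    (by rw [re_kernel_base]; linarith) hε (by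
      rw [← sub_div, sub_sub_sub_cancel_left, ← map_sub, norm_div, norm_div, Complex.norm_I,
        div_one, div_one, Complex.norm_conj, norm_sub_rev]
      refine h.trans ?_
      gcongr
      linarith [im_le_norm_sub_conj z w])
  rwa [norm_div, Complex.norm_I, div_one] at this

lemma norm_kernel_sub_le_left {α : ℝ} (hα : -1 < α) {z w z' : ℂ} (hz : z ∈ upperHalf)
    (hw : w ∈ upperHalf) (hz' : z' ∈ upperHalf) {ε : ℝ} (hε : ε ≤ 1 / 2) (hε0 : 0 ≤ ε)
    (h : ‖z - z'‖ ≤ ε * z.im) :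
    ‖kernel α z w - kernel α z' w‖ ≤ lipConst α * ε * absKernel α z w := by
  rw [kernel_conj α hz hw, kernel_conj α hz' hw, ← map_sub, Complex.norm_conj, absKernel_comm]
  exact norm_kernel_sub_le_right hα hw hz hz' hε hε0 h

lemma differentiableAt_kernel (α : ℝ) {z w : ℂ} (hz : z ∈ upperHalf) (hw : w ∈ upperHalf) :
    DifferentiableAt ℂ (fun z => kernel α z w) z := by
  have h1 : 0 < z.im := hz
  have h2 : 0 < w.im := hw
  unfold kernel
  refine DifferentiableAt.cpow_const (by fun_prop) (Or.inl ?_)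
  rw [re_kernel_base]; linarith

/-- Harnack's inequality for the positive Bergman operator. -/
lemma posOp_le_of_near {α : ℝ} (hα : -1 < α) {g : ℂ → ℝ≥0∞} (hg : Measurable g) {z z' : ℂ}
    (hz : z ∈ upperHalf) (h : ‖z - z'‖ ≤ z.im / 2) :
    posOp α g z' ≤ ENNReal.ofReal (2 ^ (α + 2)) * posOp α g z := by
  have hm : Measurable fun w => ENNReal.ofReal (absKernel α z w) * g w :=
    (((measurable_absKernel α).comp measurable_prodMk_left).ennreal_ofReal).mul hg
  rw [posOp, posOp, ← lintegral_const_mul _ hm]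
  refine lintegral_mono_ae ((ae_mem_upperHalf α).mono fun w hw => ?_)
  rw [← mul_assoc, ← ENNReal.ofReal_mul (by positivity)]
  gcongr
  exact absKernel_le_left hα hz hw h

/-! ### Radial mean values in the unit disc -/

lemma measurable_indicator_of_continuousOn {f : ℂ → ℂ} {s : Set ℂ} (hs : MeasurableSet s)
    (hf : ContinuousOn f s) : Measurable (s.indicator f) := by
  classical
  rw [← piecewise_eq_indicator]
  exact hf.measurable_piecewise continuousOn_const hs

/-- The mean value property on circles about `0`, in polar coordinates. -/
lemma integral_circle_eq {f : ℂ → ℂ} (hf : DifferentiableOn ℂ f (Metric.ball 0 1)) {r : ℝ}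
    (hr0 : 0 ≤ r) (hr1 : r < 1) :
    ∫ θ in Ioo (-Real.pi) Real.pi, f (Complex.polarCoord.symm (r, θ)) = (2 * Real.pi) • f 0 := by
  have hd : DiffContOnCl ℂ f (Metric.ball 0 |r|) :=
    hf.diffContOnCl_ball (Metric.closedBall_subset_ball (by rwa [abs_of_nonneg hr0]))
  have h := hd.circleAverage
  rw [Real.circleAverage_def] at h
  have hper : Function.Periodic (fun θ : ℝ => f (circleMap 0 r θ)) (2 * Real.pi) := by
    intro θ
    simp only [periodic_circleMap 0 r θ]
  have h2 := hper.intervalIntegral_add_eq (-Real.pi) 0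
  rw [zero_add, show -Real.pi + 2 * Real.pi = Real.pi by ring] at h2
  have hpi := Real.pi_pos
  rw [← integral_Ioc_eq_integral_Ioo, ← intervalIntegral.integral_of_le (by linarith), ← h,
    ← h2, smul_smul, mul_inv_cancel₀ (by positivity), one_smul]
  refine intervalIntegral.integral_congr fun θ _ => ?_
  simp only [Complex.polarCoord_symm_apply, circleMap, zero_add]
  rw [Complex.exp_mul_I]
  push_cast
  rfl

/-- A holomorphic function on the unit disc which is integrable for a radial weight has the same
weighted integral as the constant `f 0`. -/
lemma integral_ball_radial {f : ℂ → ℂ} (hf : DifferentiableOn ℂ f (Metric.ball 0 1)) {h : ℝ → ℝ}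
    (hh : Measurable h)
    (hint : IntegrableOn (fun z => (h ‖z‖ : ℂ) * f z) (Metric.ball 0 1)) :
    ∫ z in Metric.ball (0 : ℂ) 1, (h ‖z‖ : ℂ) * f z =
      ((2 * Real.pi * ∫ r in Ioo (0 : ℝ) 1, r * h r : ℝ) : ℂ) * f 0 := by
  set G : ℂ → ℂ := (Metric.ball (0 : ℂ) 1).indicator fun z => (h ‖z‖ : ℂ) * f z with hG
  have hGm : Measurable G := by
    have e : G = fun z => (h ‖z‖ : ℂ) * (Metric.ball (0 : ℂ) 1).indicator f z := by
      ext z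
      by_cases hz : z ∈ Metric.ball (0 : ℂ) 1 <;> simp [hG, hz]
    rw [e]
    refine Measurable.mul (by fun_prop) ?_
    exact measurable_indicator_of_continuousOn measurableSet_ball hf.continuousOn
  have hGi : Integrable G := (integrable_indicator_iff measurableSet_ball).2 hint
  have hsymm : Measurable Complex.polarCoord.symm := by
    have : (Complex.polarCoord.symm : ℝ × ℝ → ℂ) =
        fun p => (p.1 : ℂ) * (Real.cos p.2 + Real.sin p.2 * Complex.I) := by
      ext p; simp
    rw [this]; fun_prop
  have hpm : Measurable fun p : ℝ × ℝ => p.1 • G (Complex.polarCoord.symm p) :=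
    measurable_fst.smul (hGm.comp hsymm)
  have hpi : IntegrableOn (fun p : ℝ × ℝ => p.1 • G (Complex.polarCoord.symm p))
      (Ioi (0 : ℝ) ×ˢ Ioo (-Real.pi) Real.pi) := by
    refine ⟨hpm.aestronglyMeasurable, ?_⟩
    have h1 := Complex.lintegral_comp_polarCoord_symm (fun z => ‖G z‖ₑ)
    rw [polarCoord_target] at h1
    have h2 : ∫⁻ p in Ioi (0 : ℝ) ×ˢ Ioo (-Real.pi) Real.pi,
        ‖p.1 • G (Complex.polarCoord.symm p)‖ₑ = ∫⁻ z, ‖G z‖ₑ := by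
      rw [← h1]
      refine setLIntegral_congr_fun (measurableSet_Ioi.prod measurableSet_Ioo) fun p hp => ?_
      have : 0 < p.1 := hp.1
      simp only [enorm_smul, smul_eq_mul]
      rw [Real.enorm_of_nonneg this.le]
    rw [HasFiniteIntegral, h2]
    exact hGi.2
  have hrad := Complex.integral_comp_polarCoord_symm G
  rw [polarCoord_target, Measure.volume_eq_prod, setIntegral_prod _ hpi] at hrad
  rw [← integral_indicator measurableSet_ball, ← hrad]
  have inner : ∀ r ∈ Ioi (0 : ℝ),
      ∫ θ in Ioo (-Real.pi) Real.pi, r • G (Complex.polarCoord.symm (r, θ)) =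
        (Ioo (0 : ℝ) 1).indicator (fun r => (((2 * Real.pi * (r * h r) : ℝ)) : ℂ) * f 0) r := by
    intro r hr
    have hr0 : 0 < r := hr
    have hn : ∀ θ : ℝ, ‖Complex.polarCoord.symm (r, θ)‖ = r := fun θ => by
      rw [Complex.norm_polarCoord_symm, abs_of_pos hr0]
    by_cases hr1 : r < 1
    · rw [indicator_of_mem (show r ∈ Ioo (0 : ℝ) 1 from ⟨hr0, hr1⟩)]
      have e : ∀ θ : ℝ, r • G (Complex.polarCoord.symm (r, θ)) =
          ((r * h r : ℝ) : ℂ) * f (Complex.polarCoord.symm (r, θ)) := by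
        intro θ
        rw [hG, indicator_of_mem (by rw [mem_ball_zero_iff, hn θ]; exact hr1), hn θ,
          Complex.real_smul]
        push_cast; ring
      simp only [e]
      rw [integral_const_mul, integral_circle_eq hf hr0.le hr1, Complex.real_smul]
      push_cast; ring
    · rw [indicator_of_notMem (fun hmem => hr1 hmem.2)]
      have e : ∀ θ : ℝ, r • G (Complex.polarCoord.symm (r, θ)) = 0 := by
        intro θ
        rw [hG, indicator_of_notMem (by rw [mem_ball_zero_iff, hn θ]; exact hr1), smul_zero]
      simp only [e, integral_zero]
  rw [setIntegral_congr_fun measurableSet_Ioi inner, setIntegral_indicator measurableSet_Ioo,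
    inter_eq_self_of_subset_right Ioo_subset_Ioi_self, integral_mul_const, integral_complex_ofReal,
    integral_const_mul]

lemma integral_radial_weight_pos {α : ℝ} (hα : -1 < α) :
    0 < ∫ r in Ioo (0 : ℝ) 1, r * (1 - r ^ 2) ^ α := by
  set g : ℝ → ℝ := fun r => -((1 - r ^ 2) ^ (α + 1) / (2 * (α + 1)))
  have hα1 : 0 < α + 1 := by linarith
  have hcont : Continuous g := by
    refine (Continuous.div_const ?_ _).neg
    exact Continuous.rpow_const (by fun_prop) fun _ => Or.inr hα1.le
  have hder : ∀ r ∈ Ioo (0 : ℝ) 1, HasDerivAt g (r * (1 - r ^ 2) ^ α) r := by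
    intro r hr
    have hpos : 0 < 1 - r ^ 2 := by nlinarith [hr.1, hr.2]
    have h1 : HasDerivAt (fun r : ℝ => 1 - r ^ 2) (-(2 * r)) r := by
      simpa using (hasDerivAt_pow 2 r).const_sub 1
    have := ((h1.rpow_const (p := α + 1) (Or.inl hpos.ne')).div_const (2 * (α + 1))).neg
    refine this.congr_deriv ?_
    rw [add_sub_cancel_right]
    field_simp
  have hint := intervalIntegral.integrableOn_deriv_of_nonneg hcont.continuousOn hder
    fun r hr => mul_nonneg hr.1.le (Real.rpow_nonneg (by nlinarith [hr.1, hr.2]) _)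
  have hii : IntervalIntegrable (fun r : ℝ => r * (1 - r ^ 2) ^ α) volume 0 1 :=
    (intervalIntegrable_iff_integrableOn_Ioc_of_le zero_le_one).2 hint
  have := intervalIntegral.integral_eq_sub_of_hasDerivAt_of_le zero_le_one hcont.continuousOn
    hder hii
  rw [← integral_Ioc_eq_integral_Ioo, ← intervalIntegral.integral_of_le zero_le_one, this]
  simp only [g]
  norm_num
  rw [Real.zero_rpow hα1.ne']
  simp
  positivity

/-! ### The reproducing formula -/

/-- The Cayley transform of the unit disc onto `ℂ₊`. -/
def cayley (u : ℂ) : ℂ := Complex.I * (1 + u) / (1 - u)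

lemma one_sub_ne_zero_of_mem_ball {u : ℂ} (hu : u ∈ Metric.ball (0 : ℂ) 1) : 1 - u ≠ 0 := by
  intro h
  rw [sub_eq_zero] at h
  simp [← h] at hu

lemma cayley_im (u : ℂ) : (cayley u).im = (1 - ‖u‖ ^ 2) / ‖1 - u‖ ^ 2 := by
  rw [cayley, ← Complex.normSq_eq_norm_sq, ← Complex.normSq_eq_norm_sq, Complex.div_im,
    Complex.normSq_apply u]
  simp
  ring

lemma cayley_mem {u : ℂ} (hu : u ∈ Metric.ball (0 : ℂ) 1) : cayley u ∈ upperHalf := by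
  have h1 : ‖u‖ < 1 := by simpa using hu
  have h2 := norm_pos_iff.2 (one_sub_ne_zero_of_mem_ball hu)
  change 0 < (cayley u).im
  rw [cayley_im]
  have : 0 < 1 - ‖u‖ ^ 2 := by nlinarith [norm_nonneg u]
  positivity

lemma injOn_cayley : InjOn cayley (Metric.ball 0 1) := by
  intro u hu v hv h
  have h1 := one_sub_ne_zero_of_mem_ball hu
  have h2 := one_sub_ne_zero_of_mem_ball hv
  simp only [cayley] at h
  rw [div_eq_div_iff h1 h2] at h
  have h3 : Complex.I * (2 * (u - v)) = 0 := by linear_combination h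
  simpa [sub_eq_zero] using h3

lemma image_cayley : cayley '' Metric.ball 0 1 = upperHalf := by
  apply Subset.antisymm
  · rintro _ ⟨u, hu, rfl⟩
    exact cayley_mem hu
  · intro z hz
    have hz' : 0 < z.im := hz
    have hne : z + Complex.I ≠ 0 := by
      intro h
      have := congrArg Complex.im h
      simp at this
      linarith
    refine ⟨(z - Complex.I) / (z + Complex.I), ?_, ?_⟩
    · rw [mem_ball_zero_iff, norm_div, div_lt_one (norm_pos_iff.2 hne), Complex.norm_def,
        Complex.norm_def]
      apply Real.sqrt_lt_sqrt (Complex.normSq_nonneg _)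
      rw [Complex.normSq_apply, Complex.normSq_apply]
      simp
      nlinarith
    · rw [cayley]
      have e1 : 1 + (z - Complex.I) / (z + Complex.I) = 2 * z / (z + Complex.I) := by
        field_simp; ring
      have e2 : 1 - (z - Complex.I) / (z + Complex.I) = 2 * Complex.I / (z + Complex.I) := by
        field_simp; ring
      rw [e1, e2]
      field_simp

lemma hasDerivAt_cayley {u : ℂ} (hu : u ∈ Metric.ball (0 : ℂ) 1) :
    HasDerivAt cayley (2 * Complex.I / (1 - u) ^ 2) u := by
  have h1 := one_sub_ne_zero_of_mem_ball hu
  have := (((hasDerivAt_id u).const_add 1).const_mul Complex.I).div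
    ((hasDerivAt_id u).const_sub 1) h1
  refine this.congr_deriv ?_
  simp
  ring

/-- The real derivative of the Cayley transform. -/
def cayleyDeriv (u : ℂ) : ℂ →L[ℝ] ℂ :=
  (ContinuousLinearMap.toSpanSingleton ℂ (2 * Complex.I / (1 - u) ^ 2)).restrictScalars ℝ

lemma det_cayleyDeriv (u : ℂ) : |(cayleyDeriv u).det| = 4 / ‖1 - u‖ ^ 4 := by
  have : (cayleyDeriv u).det = Complex.normSq (2 * Complex.I / (1 - u) ^ 2) := by
    simp [cayleyDeriv, ContinuousLinearMap.det, LinearMap.det_restrictScalars,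
      Algebra.norm_complex_eq]
  rw [this, abs_of_nonneg (Complex.normSq_nonneg _), Complex.normSq_eq_norm_sq]
  simp
  ring

lemma absKernel_I_cayley (α : ℝ) {u : ℂ} (hu : u ∈ Metric.ball (0 : ℂ) 1) :
    absKernel α Complex.I (cayley u) = 2 ^ (-(α + 2)) * ‖1 - u‖ ^ (α + 2) := by
  have h1 := one_sub_ne_zero_of_mem_ball hu
  have h2 : (starRingEnd ℂ) (1 - u) ≠ 0 := (map_ne_zero _).2 h1
  have e : Complex.I - (starRingEnd ℂ) (cayley u) =
      2 * Complex.I / (starRingEnd ℂ) (1 - u) := by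
    rw [cayley, map_div₀, map_mul, map_add, Complex.conj_I, map_one, eq_div_iff h2]
    field_simp
    rw [map_sub, map_one]
    ring
  rw [absKernel, e, norm_div, Complex.norm_conj, Real.div_rpow (norm_nonneg _) (norm_nonneg _),
    Real.rpow_neg (norm_nonneg (1 - u)), div_inv_eq_mul]
  simp

lemma cayley_weight (α : ℝ) {u : ℂ} (hu : u ∈ Metric.ball (0 : ℂ) 1) :
    |(cayleyDeriv u).det| * (cayley u).im ^ α * absKernel α Complex.I (cayley u) ^ 2 =
      4 * (2 ^ (-(α + 2))) ^ 2 * (1 - ‖u‖ ^ 2) ^ α := by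
  have h1 : 0 < ‖1 - u‖ := norm_pos_iff.2 (one_sub_ne_zero_of_mem_ball hu)
  have h3 : ‖u‖ < 1 := by simpa using hu
  have h4 : 0 ≤ 1 - ‖u‖ ^ 2 := by nlinarith [norm_nonneg u]
  rw [det_cayleyDeriv, cayley_im, absKernel_I_cayley α hu, Real.div_rpow h4 (by positivity)]
  have e1 : (‖1 - u‖ ^ 2) ^ α = (‖1 - u‖ ^ α) ^ 2 := by
    rw [← Real.rpow_natCast, ← Real.rpow_mul h1.le, mul_comm, Real.rpow_mul h1.le,
      Real.rpow_natCast]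
  have e2 : ‖1 - u‖ ^ (α + 2) = ‖1 - u‖ ^ α * ‖1 - u‖ ^ 2 := by
    rw [Real.rpow_add h1]; norm_num
  rw [e1, e2]
  have := Real.rpow_pos_of_pos h1 α
  field_simp

lemma integral_weightedVolume (α : ℝ) (f : ℂ → ℂ) :
    ∫ z, f z ∂(weightedVolume α) = ∫ z in upperHalf, (z.im ^ α) • f z := by
  rw [weightedVolume, integral_withDensity_eq_integral_toReal_smul (measurable_weight α)
    (Eventually.of_forall fun _ => ENNReal.ofReal_lt_top)]
  refine setIntegral_congr_fun measurableSet_upperHalf fun z hz => ?_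
  have : 0 < z.im := hz
  rw [ENNReal.toReal_ofReal (by positivity)]

lemma integrable_weightedVolume_iff (α : ℝ) (f : ℂ → ℂ) :
    Integrable f (weightedVolume α) ↔ IntegrableOn (fun z => (z.im ^ α) • f z) upperHalf := by
  rw [weightedVolume, integrable_withDensity_iff_integrable_smul' (measurable_weight α)
    (Eventually.of_forall fun _ => ENNReal.ofReal_lt_top)]
  refine integrableOn_congr_fun (fun z hz => ?_) measurableSet_upperHalf
  have : 0 < z.im := hz
  rw [ENNReal.toReal_ofReal (by positivity)]

lemma I_mem_upperHalf : Complex.I ∈ upperHalf := by simp [upperHalf]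

/-- The reproducing formula at `i`: the Cayley transform turns it into the radial mean value
property of `F / K(·, i)`, since `K(i, w) F(w) = |K(i, w)|² F(w) / K(w, i)`. -/
lemma reproducing_I {α : ℝ} (hα : -1 < α) :
    ∃ c : ℂ, c ≠ 0 ∧ ∀ F : ℂ → ℂ, DifferentiableOn ℂ F upperHalf →
      Integrable (fun w => kernel α Complex.I w * F w) (weightedVolume α) →
      ∫ w, kernel α Complex.I w * F w ∂(weightedVolume α) = c * F Complex.I := by
  set c₁ : ℝ := 2 * Real.pi *
    ∫ r in Ioo (0 : ℝ) 1, r * (4 * (2 ^ (-(α + 2))) ^ 2 * (1 - r ^ 2) ^ α)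
  have hc₁ : c₁ ≠ 0 := by
    have h := integral_radial_weight_pos hα
    have e : ∀ r : ℝ, r * (4 * ((2 : ℝ) ^ (-(α + 2))) ^ 2 * (1 - r ^ 2) ^ α) =
        4 * (2 ^ (-(α + 2))) ^ 2 * (r * (1 - r ^ 2) ^ α) := fun r => by ring
    simp only [c₁, e]
    rw [integral_const_mul]
    positivity
  have hII := kernel_ne_zero α I_mem_upperHalf I_mem_upperHalf
  refine ⟨c₁ / kernel α Complex.I Complex.I, div_ne_zero (by exact_mod_cast hc₁) hII,
    fun F hF hint => ?_⟩
  have hcF : ∀ u ∈ Metric.ball (0 : ℂ) 1, HasFDerivWithinAt cayley (cayleyDeriv u)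
      (Metric.ball 0 1) u := fun u hu =>
    ((hasDerivAt_cayley hu).hasFDerivAt.restrictScalars ℝ).hasFDerivWithinAt
  set f : ℂ → ℂ := fun u => F (cayley u) / kernel α (cayley u) Complex.I with hf
  have hfd : DifferentiableOn ℂ f (Metric.ball 0 1) := by
    intro u hu
    have hcm := cayley_mem hu
    refine DifferentiableAt.differentiableWithinAt ?_
    have hdc := (hasDerivAt_cayley hu).differentiableAt
    refine DifferentiableAt.div ?_ ?_ (kernel_ne_zero α hcm I_mem_upperHalf)
    · exact (hF.differentiableAt (isOpen_upperHalf.mem_nhds hcm)).comp u hdc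
    · exact (differentiableAt_kernel α hcm I_mem_upperHalf).comp u hdc
  have hpt : ∀ u ∈ Metric.ball (0 : ℂ) 1,
      |(cayleyDeriv u).det| • ((cayley u).im ^ α • (kernel α Complex.I (cayley u) * F (cayley u)))
        = ((4 * (2 ^ (-(α + 2))) ^ 2 * (1 - ‖u‖ ^ 2) ^ α : ℝ) : ℂ) * f u := by
    intro u hu
    have hcm := cayley_mem hu
    have hk := kernel_ne_zero α hcm I_mem_upperHalf
    rw [← cayley_weight α hu]
    have e : kernel α Complex.I (cayley u) * F (cayley u) =
        ((absKernel α Complex.I (cayley u) ^ 2 : ℝ) : ℂ) * f u := by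
      rw [hf, absKernel_comm, ← norm_kernel, ← Complex.normSq_eq_norm_sq,
        Complex.normSq_eq_conj_mul_self, ← kernel_conj α I_mem_upperHalf hcm]
      field_simp
    rw [e, Complex.real_smul, Complex.real_smul]
    push_cast
    ring
  have hint' : IntegrableOn (fun u => ((4 * (2 ^ (-(α + 2))) ^ 2 * (1 - ‖u‖ ^ 2) ^ α : ℝ) : ℂ) *
      f u) (Metric.ball 0 1) := by
    rw [integrable_weightedVolume_iff, ← image_cayley,
      integrableOn_image_iff_integrableOn_abs_det_fderiv_smul _ measurableSet_ball hcF
        injOn_cayley] at hint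
    exact hint.congr_fun hpt measurableSet_ball
  rw [integral_weightedVolume, ← image_cayley,
    integral_image_eq_integral_abs_det_fderiv_smul _ measurableSet_ball hcF injOn_cayley,
    setIntegral_congr_fun measurableSet_ball hpt,
    integral_ball_radial (h := fun r => 4 * (2 ^ (-(α + 2))) ^ 2 * (1 - r ^ 2) ^ α) hfd
      (by fun_prop) hint']
  have hc0 : cayley 0 = Complex.I := by simp [cayley]
  simp only [hf, hc0]
  ring

lemma measurable_kernel (α : ℝ) (z : ℂ) : Measurable (kernel α z) := by
  unfold kernel
  exact ((measurable_const.sub (RCLike.continuous_conj.measurable)).div_const _).pow_const _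

lemma aestronglyMeasurable_of_differentiableOn (α : ℝ) {F : ℂ → ℂ}
    (hF : DifferentiableOn ℂ F upperHalf) : AEStronglyMeasurable F (weightedVolume α) := by
  rw [← weightedVolume_restrict]
  exact hF.continuousOn.aestronglyMeasurable measurableSet_upperHalf

/-- The modulus of a function on `ℂ₊`, extended by zero. -/
def absOn (F : ℂ → ℂ) : ℂ → ℝ≥0∞ := fun z => ‖upperHalf.indicator F z‖ₑ

lemma measurable_absOn {F : ℂ → ℂ} (hF : DifferentiableOn ℂ F upperHalf) :
    Measurable (absOn F) :=
  (measurable_indicator_of_continuousOn measurableSet_upperHalf hF.continuousOn).enorm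

lemma absOn_of_mem {F : ℂ → ℂ} {z : ℂ} (hz : z ∈ upperHalf) : absOn F z = ‖F z‖ₑ := by
  rw [absOn, indicator_of_mem hz]

lemma integrable_kernel_mul (α : ℝ) {F : ℂ → ℂ} (hF : DifferentiableOn ℂ F upperHalf) {z : ℂ}
    (hfin : posOp α (absOn F) z ≠ ∞) :
    Integrable (fun w => kernel α z w * F w) (weightedVolume α) := by
  refine ⟨(measurable_kernel α z).aestronglyMeasurable.mul
    (aestronglyMeasurable_of_differentiableOn α hF), ?_⟩
  rw [HasFiniteIntegral]
  refine lt_of_eq_of_lt (lintegral_congr_ae ((ae_mem_upperHalf α).mono fun w hw => ?_))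
    hfin.lt_top
  simp only
  rw [enorm_mul, absOn_of_mem hw, ← ofReal_norm, norm_kernel]

/-- The reproducing formula, for holomorphic functions that are absolutely integrable against
the kernel; it follows from the case `z = i` by the affine automorphism moving `i` to `z`. -/
lemma reproducing {α : ℝ} (hα : -1 < α) :
    ∃ c : ℂ, c ≠ 0 ∧ ∀ F : ℂ → ℂ, DifferentiableOn ℂ F upperHalf → ∀ z ∈ upperHalf,
      posOp α (absOn F) z ≠ ∞ →
      ∫ w, kernel α z w * F w ∂(weightedVolume α) = c * F z := by
  obtain ⟨c, hc, h⟩ := reproducing_I hα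
  refine ⟨c, hc, fun F hF z hz hfin => ?_⟩
  have hz' : 0 < z.im := hz
  set G : ℂ → ℂ := fun w => F (halfPlaneAct z w) with hGdef
  have hG : DifferentiableOn ℂ G upperHalf := by
    intro w hw
    refine DifferentiableAt.differentiableWithinAt ?_
    refine DifferentiableAt.comp w
      (hF.differentiableAt (isOpen_upperHalf.mem_nhds (halfPlaneAct_mem hz hw))) ?_
    have : halfPlaneAct z = fun w => (z.re : ℂ) + z.im * w := funext (halfPlaneAct_eq z)
    rw [this]; fun_prop
  have hGabs : ∀ w ∈ upperHalf, absOn G w = absOn F (halfPlaneAct z w) := fun w hw => by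
    rw [absOn_of_mem hw, absOn_of_mem (halfPlaneAct_mem hz hw)]
  have hGfin : posOp α (absOn G) Complex.I ≠ ∞ := by
    rw [posOp_eq α (measurable_absOn hF) hz] at hfin
    refine ne_of_eq_of_ne (lintegral_congr_ae ((ae_mem_upperHalf α).mono fun w hw => ?_)) hfin
    simp only
    rw [hGabs w hw]
  have hI := h G hG (integrable_kernel_mul α hG hGfin)
  have hGI : G Complex.I = F z := by
    simp only [hGdef]
    congr 1
    apply Complex.ext <;> simp [halfPlaneAct]
  have hact : Measurable (halfPlaneAct z) := measurable_halfPlaneAct.comp measurable_prodMk_left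
  have hmap := map_halfPlaneAct α hz
  have hsm : AEStronglyMeasurable (fun w => kernel α z w * F w) (weightedVolume α) :=
    (integrable_kernel_mul α hF hfin).1
  have hchange : ∫ w, kernel α z (halfPlaneAct z w) * F (halfPlaneAct z w) ∂(weightedVolume α) =
      (z.im ^ (-(α + 2)) : ℝ) • ∫ w, kernel α z w * F w ∂(weightedVolume α) := by
    rw [← integral_map (φ := halfPlaneAct z) (f := fun w => kernel α z w * F w) hact.aemeasurable
      (by rw [hmap]; exact hsm.smul_measure _), hmap, integral_smul_measure,
      ENNReal.toReal_ofReal (by positivity)]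
  have hy : z.im ^ (-(α + 2)) ≠ 0 := (Real.rpow_pos_of_pos hz' _).ne'
  have hlhs : ∫ w, kernel α z (halfPlaneAct z w) * F (halfPlaneAct z w) ∂(weightedVolume α) =
      (z.im ^ (-(α + 2)) : ℝ) • ∫ w, kernel α Complex.I w * G w ∂(weightedVolume α) := by
    rw [← integral_smul]
    refine integral_congr_ae ((ae_mem_upperHalf α).mono fun w hw => ?_)
    simp only
    rw [kernel_halfPlaneAct α hz hw, Complex.real_smul, mul_assoc]
  rw [hlhs, hI, hGI] at hchange
  exact (smul_right_injective ℂ hy hchange).symm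

/-! ### Modular bounds -/

/-- The modular of `g / lam` in `L^Φ(y ^ α dx dy)` is at most `1`, that is, `g` has Luxemburg norm
at most `lam`. -/
def ModBound (α : ℝ) (Φ : ℝ → ℝ) (g : ℂ → ℝ≥0∞) (lam : ℝ) : Prop :=
  ∫⁻ z, extPhi Φ (g z / ENNReal.ofReal lam) ∂(weightedVolume α) ≤ 1

section ModBound

variable {α : ℝ} {Φ : ℝ → ℝ} {g g' : ℂ → ℝ≥0∞} {lam : ℝ}

lemma ModBound.mono (hΦ : ClassU Φ) (h : ModBound α Φ g' lam) (hle : ∀ z ∈ upperHalf, g z ≤ g' z) :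
    ModBound α Φ g lam := by
  refine (lintegral_mono_ae ((ae_mem_upperHalf α).mono fun z hz => ?_)).trans h
  apply hΦ.growth.extPhi_mono
  gcongr
  exact hle z hz

lemma ModBound.const_mul (h : ModBound α Φ g lam) {c : ℝ} (hc : 0 < c) :
    ModBound α Φ (fun z => ENNReal.ofReal c * g z) (c * lam) := by
  unfold ModBound at h ⊢
  convert h using 4 with z
  rw [ENNReal.ofReal_mul hc.le]
  exact ENNReal.mul_div_mul_left _ _ (by simpa using hc) ENNReal.ofReal_ne_top

/-- A bound `c ≥ 1` for the modular is a bound `c * lam` for the norm, by convexity. -/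
lemma ModBound.of_le_ofReal (hΦ : ClassU Φ) {c : ℝ} (hc : 1 ≤ c) (hg : Measurable g)
    (h : ∫⁻ z, extPhi Φ (g z / ENNReal.ofReal lam) ∂(weightedVolume α) ≤ ENNReal.ofReal c) :
    ModBound α Φ g (c * lam) := by
  have hc0 : 0 < c := by linarith
  have hm := hΦ.growth.measurable_extPhi
  have e : ∀ z, extPhi Φ (g z / ENNReal.ofReal (c * lam)) ≤
      extPhi Φ (g z / ENNReal.ofReal lam) * (ENNReal.ofReal c)⁻¹ := by
    intro z
    rw [← div_eq_mul_inv]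
    refine le_trans (le_of_eq ?_) (hΦ.extPhi_div_le hc _)
    rw [mul_comm c, ENNReal.ofReal_mul' hc0.le, div_eq_mul_inv, div_eq_mul_inv, div_eq_mul_inv,
      ENNReal.mul_inv (by simp) (by simp [hc0]), mul_assoc]
  refine (lintegral_mono e).trans ?_
  have hmg : Measurable fun z => extPhi Φ (g z / ENNReal.ofReal lam) := hm.comp (hg.div_const _)
  rw [lintegral_mul_const _ hmg, ← div_eq_mul_inv]
  exact ENNReal.div_le_of_le_mul (by simpa using h)

/-- A countable triangle inequality for norms that decay geometrically. -/
lemma ModBound.tsum (hΦ : ClassU Φ) {g : ℕ → ℂ → ℝ≥0∞} (hg : ∀ n, Measurable (g n))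
    (hlam : 0 < lam) (h : ∀ n, ModBound α Φ (g n) (lam / 2 ^ n)) :
    ModBound α Φ (fun z => ∑' n, g n z) (2 * lam) := by
  have hm := hΦ.growth.measurable_extPhi
  have hw : ∑' n : ℕ, (ENNReal.ofReal ((1 / 2) ^ (n + 1))) = 1 := by
    rw [← ENNReal.ofReal_tsum_of_nonneg (fun n => by positivity)
      ((summable_nat_add_iff 1).2 summable_geometric_two)]
    have : ∑' n : ℕ, ((1 : ℝ) / 2) ^ (n + 1) = 1 := by
      simp_rw [pow_succ]
      rw [tsum_mul_right, tsum_geometric_two]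
      norm_num
    rw [this, ENNReal.ofReal_one]
  have hpt : ∀ z, extPhi Φ ((∑' n, g n z) / ENNReal.ofReal (2 * lam)) ≤
      ∑' n : ℕ, ENNReal.ofReal ((1 / 2) ^ (n + 1)) *
        extPhi Φ (g n z / ENNReal.ofReal (lam / 2 ^ n)) := by
    intro z
    refine le_trans (le_of_eq ?_) (hΦ.jensen_tsum hw.le _)
    rw [div_eq_mul_inv, ← ENNReal.tsum_mul_right]
    congr 2 with n
    rw [div_eq_mul_inv (g n z), mul_left_comm, ← ENNReal.ofReal_inv_of_pos (by positivity),
      ← ENNReal.ofReal_inv_of_pos (by positivity), ← ENNReal.ofReal_mul (by positivity)]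
    congr 2
    rw [pow_succ, one_div, inv_pow]
    field_simp
  refine (lintegral_mono hpt).trans ?_
  have hmg : ∀ n, Measurable fun z => extPhi Φ (g n z / ENNReal.ofReal (lam / 2 ^ n)) :=
    fun n => hm.comp ((hg n).div_const _)
  rw [lintegral_tsum fun n => ((hmg n).const_mul _).aemeasurable, ← hw]
  refine ENNReal.tsum_le_tsum fun n => ?_
  rw [lintegral_const_mul _ (hmg n)]
  exact mul_le_of_le_one_right' (h n)

/-- The positive Bergman operator is bounded on `L^Φ(y ^ α dx dy)`. -/
lemma ClassU.exists_posOp_modBound (hΦ : ClassU Φ) (hΨ : Delta2 (complementary Φ))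
    (hα : -1 < α) :
    ∃ M : ℝ, 0 < M ∧ ∀ (g : ℂ → ℝ≥0∞) (lam : ℝ), Measurable g → 0 < lam → ModBound α Φ g lam →
      ModBound α Φ (posOp α g) (M * lam) := by
  obtain ⟨M, hM, h⟩ := hΦ.modular_posOp_le hΨ hα
  refine ⟨M, hM, fun g lam hg hlam hb => ?_⟩
  refine le_trans (le_of_eq ?_) ((h (fun w => (ENNReal.ofReal lam)⁻¹ * g w)
    (hg.const_mul _)).trans (le_trans (le_of_eq ?_) hb))
  · refine lintegral_congr fun z => ?_
    rw [posOp_const_mul α hg, ENNReal.ofReal_mul hM.le, div_eq_mul_inv, div_eq_mul_inv,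
      ENNReal.mul_inv (by simp [hM]) (by simp)]
    ring_nf
  · refine lintegral_congr fun z => ?_
    rw [div_eq_mul_inv, mul_comm]

lemma weightedVolume_pos_of_isOpen (α : ℝ) {U : Set ℂ} (hU : IsOpen U) (hne : U.Nonempty)
    (hsub : U ⊆ upperHalf) : 0 < weightedVolume α U := by
  rw [pos_iff_ne_zero]
  intro h0
  rw [weightedVolume, withDensity_apply_eq_zero (measurable_weight α)] at h0
  have : {z : ℂ | ENNReal.ofReal (z.im ^ α) ≠ 0} ∩ U = U := by
    apply inter_eq_right.2
    intro z hz
    have : 0 < z.im := hsub hz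
    simpa using Real.rpow_pos_of_pos this α
  rw [this, Measure.restrict_apply hU.measurableSet, inter_eq_left.2 hsub] at h0
  exact (hU.measure_pos volume hne).ne' h0

/-- Pointwise values of `posOp α g` are controlled by its Luxemburg norm, by Harnack's
inequality. -/
lemma ClassU.exists_posOp_le (hΦ : ClassU Φ) (hα : -1 < α) {z : ℂ} (hz : z ∈ upperHalf) :
    ∃ D : ℝ, 0 < D ∧ ∀ (g : ℂ → ℝ≥0∞) (lam : ℝ), Measurable g → 0 < lam →
      ModBound α Φ (posOp α g) lam → posOp α g z ≤ ENNReal.ofReal (D * lam) := by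
  have hz' : 0 < z.im := hz
  set B := Metric.ball z (z.im / 3)
  have hB : ∀ w ∈ B, w ∈ upperHalf ∧ ‖w - z‖ ≤ w.im / 2 := by
    intro w hw
    have h1 : ‖w - z‖ < z.im / 3 := by simpa [B, dist_eq_norm] using hw
    have h2 := (abs_le.1 (Complex.abs_im_le_norm (w - z))).1
    rw [Complex.sub_im] at h2
    refine ⟨?_, by linarith⟩
    change 0 < w.im
    linarith
  have hVB := weightedVolume_pos_of_isOpen α (U := B) Metric.isOpen_ball
    (Metric.nonempty_ball.2 (by positivity)) fun w hw => (hB w hw).1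
  obtain ⟨t, ht1, ht⟩ : ∃ t : ℝ, 1 ≤ t ∧ (weightedVolume α B)⁻¹ < ENNReal.ofReal (Φ t) := by
    have h1 := hΦ.growth.tendsto_atTop.eventually_gt_atTop (weightedVolume α B)⁻¹.toReal
    obtain ⟨t, ht, ht1⟩ := (h1.and (eventually_ge_atTop 1)).exists
    refine ⟨t, ht1, ?_⟩
    rw [← ENNReal.ofReal_toReal (a := (weightedVolume α B)⁻¹) (by simpa using hVB.ne')]
    exact (ENNReal.ofReal_lt_ofReal_iff (hΦ.growth.pos t (by linarith))).2 ht
  have ht0 : 0 < t := by linarith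
  refine ⟨2 ^ (α + 2) * t, by positivity, fun g lam hg hlam hb => ?_⟩
  by_contra! hcon
  have hlow : ∀ w ∈ B, ENNReal.ofReal (Φ t) ≤ extPhi Φ (posOp α g w / ENNReal.ofReal lam) := by
    intro w hw
    rw [← extPhi_ofReal ht0.le]
    apply hΦ.growth.extPhi_mono
    rw [ENNReal.le_div_iff_mul_le (by simp [hlam]) (by simp), ← ENNReal.ofReal_mul ht0.le]
    have h1 := hcon.le.trans (posOp_le_of_near hα hg (hB w hw).1 (hB w hw).2)
    rw [mul_assoc, ENNReal.ofReal_mul (by positivity)] at h1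
    exact (ENNReal.mul_le_mul_iff_right (by simp; positivity) ENNReal.ofReal_ne_top).1 h1
  have h2 : ENNReal.ofReal (Φ t) * weightedVolume α B ≤ 1 := by
    calc ENNReal.ofReal (Φ t) * weightedVolume α B
        = ∫⁻ _ in B, ENNReal.ofReal (Φ t) ∂(weightedVolume α) := by rw [setLIntegral_const]
      _ ≤ ∫⁻ w in B, extPhi Φ (posOp α g w / ENNReal.ofReal lam) ∂(weightedVolume α) :=
          setLIntegral_mono' measurableSet_ball hlow
      _ ≤ _ := setLIntegral_le_lintegral _ _
      _ ≤ 1 := hb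
  rw [← ENNReal.le_div_iff_mul_le (Or.inl hVB.ne') (Or.inr ENNReal.one_ne_top), one_div] at h2
  exact absurd h2 (not_le.2 ht)

/-- The Bergman–Orlicz norm only sees the function on `ℂ₊`. -/
lemma bergmanNorm_eq (α : ℝ) (Φ : ℝ → ℝ) (F : ℂ → ℂ) :
    bergmanNorm α Φ F =
      ⨅ (lam : ℝ) (_ : 0 < lam ∧ ModBound α Φ (absOn F) lam), ENNReal.ofReal lam := by
  rw [bergmanNorm, luxNorm]
  refine iInf_congr fun lam => iInf_congr_Prop (and_congr_right fun hlam => ?_) fun _ => rfl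
  have e : ∫⁻ z, ENNReal.ofReal (Φ (‖F z‖ / lam)) ∂(weightedVolume α) =
      ∫⁻ z, extPhi Φ (absOn F z / ENNReal.ofReal lam) ∂(weightedVolume α) := by
    refine lintegral_congr_ae ((ae_mem_upperHalf α).mono fun z hz => ?_)
    simp only
    rw [absOn_of_mem hz, extPhi_enorm_div (F z) hlam]
  rw [ModBound, e]

end ModBound

/-! ### Consequences of the reproducing formula -/

/-- Holomorphic functions are pointwise dominated by the positive Bergman operator. -/
lemma exists_enorm_le_posOp {α : ℝ} (hα : -1 < α) :
    ∃ c : ℝ, 0 < c ∧ ∀ F : ℂ → ℂ, DifferentiableOn ℂ F upperHalf →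
      (∀ z ∈ upperHalf, ‖F z‖ₑ ≤ ENNReal.ofReal c * posOp α (absOn F) z) ∧
      ∀ z ∈ upperHalf, ∀ z' ∈ upperHalf, ∀ ε : ℝ, 0 < ε → ε ≤ 1 / 2 → ‖z - z'‖ ≤ ε * z.im →
        ‖F z - F z'‖ₑ ≤ ENNReal.ofReal (c * ε) * posOp α (absOn F) z := by
  obtain ⟨c, hc, hrep⟩ := reproducing hα
  have hc' : 0 < ‖c‖ := norm_pos_iff.2 hc
  have hL := lipConst_pos hα
  refine ⟨max ‖c‖⁻¹ (‖c‖⁻¹ * lipConst α), by positivity, fun F hF => ⟨fun z hz => ?_, ?_⟩⟩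
  · refine le_trans ?_ (mul_le_mul_left (ENNReal.ofReal_le_ofReal (le_max_left _ _)) _)
    rcases eq_or_ne (posOp α (absOn F) z) ∞ with htop | htop
    · simp [htop, ENNReal.mul_top, hc]
    have e : F z = c⁻¹ * ∫ w, kernel α z w * F w ∂(weightedVolume α) := by
      rw [hrep F hF z hz htop]; field_simp
    rw [e, enorm_mul, ← ofReal_norm, norm_inv]
    gcongr
    refine (enorm_integral_le_lintegral_enorm _).trans_eq ?_
    refine lintegral_congr_ae ((ae_mem_upperHalf α).mono fun w hw => ?_)
    simp only
    rw [enorm_mul, absOn_of_mem hw, ← ofReal_norm, norm_kernel]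
  · intro z hz z' hz' ε hε0 hε hzz'
    refine le_trans ?_ (mul_le_mul_left (ENNReal.ofReal_le_ofReal
      (mul_le_mul_of_nonneg_right (le_max_right _ _) hε0.le)) _)
    rcases eq_or_ne (posOp α (absOn F) z) ∞ with htop | htop
    · rw [htop, ENNReal.mul_top (by simp; positivity)]
      exact le_top
    have hmF := measurable_absOn hF
    have hz0 : 0 < z.im := hz
    have htop' : posOp α (absOn F) z' ≠ ∞ :=
      ne_top_of_le_ne_top (ENNReal.mul_ne_top ENNReal.ofReal_ne_top htop)
        (posOp_le_of_near hα hmF hz (hzz'.trans (by nlinarith)))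
    have e : F z - F z' = c⁻¹ * ∫ w, (kernel α z w - kernel α z' w) * F w
        ∂(weightedVolume α) := by
      simp only [sub_mul]
      rw [integral_sub (integrable_kernel_mul α hF htop) (integrable_kernel_mul α hF htop'),
        hrep F hF z hz htop, hrep F hF z' hz' htop']
      field_simp
    have hm : Measurable fun w => ENNReal.ofReal (absKernel α z w) * absOn F w :=
      (((measurable_absKernel α).comp measurable_prodMk_left).ennreal_ofReal).mul hmF
    rw [e, enorm_mul, ← ofReal_norm, norm_inv, mul_assoc, ENNReal.ofReal_mul (by positivity),
      mul_assoc]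
    gcongr
    refine (enorm_integral_le_lintegral_enorm _).trans ?_
    rw [posOp, ← lintegral_const_mul _ hm]
    refine lintegral_mono_ae ((ae_mem_upperHalf α).mono fun w hw => ?_)
    rw [enorm_mul, absOn_of_mem hw, ← ofReal_norm (_ - _), ← mul_assoc,
      ← ENNReal.ofReal_mul (by positivity)]
    gcongr
    exact norm_kernel_sub_le_left hα hz hw hz' hε hε0.le hzz'

/-! ### The lattice and its cells -/

section Lattice

/-- The index `(l, j)` of the lattice cell `[δ² l h / 8, δ² (l + 1) h / 8) × [h, 2 ^ γ h)`,
`h = 2 ^ (γ j)`, containing a point of `ℂ₊`. -/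
def cellIdx (δ γ : ℝ) (w : ℂ) : ℤ × ℤ :=
  (⌊w.re / (δ ^ 2 / 8 * (2 : ℝ) ^ (γ * ⌊Real.logb 2 w.im / γ⌋))⌋, ⌊Real.logb 2 w.im / γ⌋)

lemma measurable_cellIdx (δ γ : ℝ) : Measurable (cellIdx δ γ) := by
  have h1 : Measurable fun w : ℂ => ⌊Real.logb 2 w.im / γ⌋ := by
    refine Measurable.floor ?_
    unfold Real.logb
    fun_prop
  have h2 : Measurable fun n : ℤ => (2 : ℝ) ^ (γ * n) := measurable_from_top
  exact (Measurable.floor (Complex.measurable_re.div ((h2.comp h1).const_mul _))).prodMk h1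

variable {δ γ : ℝ}

lemma IsLatticeExponent.pos (hδ : 0 < δ) (hδ1 : δ < 1) (hγ : IsLatticeExponent δ γ) : 0 < γ := by
  refine lt_trans ?_ hγ.1
  have : 0 < δ ^ 2 := by positivity
  have : δ ^ 2 < 1 := by nlinarith
  have h1 : 1 < (1 + δ ^ 2 / 20) / (1 - δ ^ 2 / 20) := by
    rw [one_lt_div (by linarith)]; linarith
  have := Real.log_pos h1
  have := Real.log_pos one_lt_two
  positivity

/-- The bound on the ratio of the heights of consecutive rows that keeps each cell within
hyperbolic distance of order `δ²` of its lattice point. -/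
lemma IsLatticeExponent.two_rpow_le (hδ : 0 < δ) (hδ1 : δ < 1) (hγ : IsLatticeExponent δ γ) :
    (2 : ℝ) ^ γ ≤ 1 + δ ^ 2 / 6 := by
  have h0 : 0 < δ ^ 2 := by positivity
  have h1 : δ ^ 2 < 1 := by nlinarith
  have hR : (1 + δ ^ 2 / 4) / (1 - δ ^ 2 / 4) ≤ 1 + 4 * (δ ^ 2 / 6) := by
    rw [div_le_iff₀ (by linarith)]; nlinarith
  have hlog := Real.log_pos one_lt_two
  have h2 : Real.log ((2 : ℝ) ^ γ) * 4 < Real.log ((1 + δ ^ 2 / 4) / (1 - δ ^ 2 / 4)) := by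
    have := hγ.2
    rw [lt_div_iff₀ (by positivity)] at this
    rw [Real.log_rpow two_pos]
    linarith
  have h3 : ((2 : ℝ) ^ γ) ^ 4 < (1 + δ ^ 2 / 4) / (1 - δ ^ 2 / 4) := by
    have h4 : 0 < 1 - δ ^ 2 / 4 := by linarith
    rw [← Real.log_lt_log_iff (by positivity) (by positivity), Real.log_pow]
    push_cast
    linarith
  have h5 : 1 + 4 * (δ ^ 2 / 6) ≤ (1 + δ ^ 2 / 6) ^ 4 := by
    have := one_add_mul_le_pow (a := δ ^ 2 / 6) (by linarith) 4
    push_cast at this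
    exact this
  exact (pow_le_pow_iff_left₀ (by positivity) (by positivity) (by norm_num)).1
    (h3.le.trans (hR.trans h5))

lemma cellIdx_eq_iff (hδ : 0 < δ) (hγ : 0 < γ) {w : ℂ} (hw : w ∈ upperHalf) (l j : ℤ) :
    cellIdx δ γ w = (l, j) ↔
      (δ ^ 2 / 8 * l * (2 : ℝ) ^ (γ * j) ≤ w.re ∧ w.re < δ ^ 2 / 8 * (l + 1) * (2 : ℝ) ^ (γ * j)) ∧
      ((2 : ℝ) ^ (γ * j) ≤ w.im ∧ w.im < (2 : ℝ) ^ γ * (2 : ℝ) ^ (γ * j)) := by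
  have hw' : 0 < w.im := hw
  have hj : ⌊Real.logb 2 w.im / γ⌋ = j ↔
      ((2 : ℝ) ^ (γ * j) ≤ w.im ∧ w.im < (2 : ℝ) ^ γ * (2 : ℝ) ^ (γ * j)) := by
    rw [Int.floor_eq_iff, le_div_iff₀ hγ, div_lt_iff₀ hγ, ← Real.rpow_add two_pos,
      Real.le_logb_iff_rpow_le one_lt_two hw', Real.logb_lt_iff_lt_rpow one_lt_two hw',
      mul_comm γ, show ((j : ℝ) + 1) * γ = γ + j * γ by ring]
  rw [cellIdx, Prod.mk.injEq, ← hj]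
  refine and_congr_left fun h => ?_
  rw [h, Int.floor_eq_iff]
  have : 0 < δ ^ 2 / 8 * (2 : ℝ) ^ (γ * j) := by positivity
  rw [le_div_iff₀ this, div_lt_iff₀ this]
  constructor <;> rintro ⟨h1, h2⟩ <;> constructor <;> linarith

lemma latticePoint_re (δ γ : ℝ) (l j : ℤ) :
    (latticePoint δ γ l j).re = δ ^ 2 / 8 * l * (2 : ℝ) ^ (γ * j) := by
  simp only [latticePoint, Complex.add_re, Complex.ofReal_re, Complex.mul_re, Complex.I_re,
    Complex.I_im, Complex.ofReal_im]
  rw [Real.rpow_sub two_pos]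
  norm_num
  ring

lemma latticePoint_im (δ γ : ℝ) (l j : ℤ) :
    (latticePoint δ γ l j).im = (2 : ℝ) ^ (γ * j) := by
  simp only [latticePoint, Complex.add_im, Complex.ofReal_re, Complex.mul_im, Complex.I_re,
    Complex.I_im, Complex.ofReal_im]
  ring

lemma latticePoint_mem (δ γ : ℝ) (l j : ℤ) : latticePoint δ γ l j ∈ upperHalf := by
  change 0 < (latticePoint δ γ l j).im
  rw [latticePoint_im]; positivity

/-- The lattice point of the cell containing `w`. -/
def cellPoint (δ γ : ℝ) (w : ℂ) : ℂ := latticePoint δ γ (cellIdx δ γ w).1 (cellIdx δ γ w).2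

lemma norm_sub_cellPoint_le (hδ : 0 < δ) (hδ1 : δ < 1) (hγ : IsLatticeExponent δ γ) {w : ℂ}
    (hw : w ∈ upperHalf) :
    ‖w - cellPoint δ γ w‖ ≤ δ ^ 2 / 3 * (cellPoint δ γ w).im ∧ (cellPoint δ γ w).im ≤ w.im := by
  obtain ⟨⟨h1, h2⟩, h3, h4⟩ := (cellIdx_eq_iff hδ (hγ.pos hδ hδ1) hw (cellIdx δ γ w).1
    (cellIdx δ γ w).2).1 rfl
  have h5 := hγ.two_rpow_le hδ hδ1
  have hpos : 0 < (2 : ℝ) ^ (γ * (cellIdx δ γ w).2) := by positivity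
  have hnorm := Complex.norm_le_abs_re_add_abs_im (w - cellPoint δ γ w)
  simp only [cellPoint, Complex.sub_re, Complex.sub_im, latticePoint_re, latticePoint_im] at *
  refine ⟨hnorm.trans ?_, h3⟩
  rw [abs_of_nonneg (by linarith), abs_of_nonneg (by linarith)]
  have : 0 ≤ δ ^ 2 * (2 : ℝ) ^ (γ * (cellIdx δ γ w).2) := by positivity
  nlinarith

lemma norm_sub_cellPoint_le' (hδ : 0 < δ) (hδ1 : δ < 1) (hγ : IsLatticeExponent δ γ) {w : ℂ}
    (hw : w ∈ upperHalf) : ‖w - cellPoint δ γ w‖ ≤ δ ^ 2 / 3 * w.im := by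
  obtain ⟨h1, h2⟩ := norm_sub_cellPoint_le hδ hδ1 hγ hw
  exact h1.trans (by gcongr)

lemma latticeWeight_eq (α γ : ℝ) (j : ℤ) :
    latticeWeight α γ j = ((2 : ℝ) ^ (γ * j)) ^ (α + 2) := by
  rw [latticeWeight, ← Real.rpow_mul two_pos.le]
  congr 1; ring

lemma latticeWeight_pos (α γ : ℝ) (j : ℤ) : 0 < latticeWeight α γ j := by
  rw [latticeWeight]; positivity

/-- The measure of the cell with index `(0, 0)`. -/
def cellVol (α δ γ : ℝ) : ℝ≥0∞ := weightedVolume α (cellIdx δ γ ⁻¹' {(0, 0)})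

lemma weightedVolume_cell (α : ℝ) (hδ : 0 < δ) (hγ : 0 < γ) (l j : ℤ) :
    weightedVolume α (cellIdx δ γ ⁻¹' {(l, j)}) =
      ENNReal.ofReal (latticeWeight α γ j) * cellVol α δ γ := by
  have hmeas : ∀ p : ℤ × ℤ, MeasurableSet (cellIdx δ γ ⁻¹' {p}) := fun p =>
    measurable_cellIdx δ γ (measurableSet_singleton p)
  have hz := latticePoint_mem δ γ l j
  have hpos : 0 < (2 : ℝ) ^ (γ * j) := by positivity
  have h := lintegral_halfPlaneAct_left α
    (measurable_one.indicator (hmeas (l, j)) : Measurable ((cellIdx δ γ ⁻¹' {(l, j)}).indicator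
      (1 : ℂ → ℝ≥0∞))) hz
  rw [lintegral_indicator_one (hmeas _), latticePoint_im] at h
  have e : ∀ w ∈ upperHalf, (cellIdx δ γ ⁻¹' {(l, j)}).indicator (1 : ℂ → ℝ≥0∞)
      (halfPlaneAct (latticePoint δ γ l j) w) =
      (cellIdx δ γ ⁻¹' {(0, 0)}).indicator (1 : ℂ → ℝ≥0∞) w := by
    intro w hw
    have hiff : cellIdx δ γ (halfPlaneAct (latticePoint δ γ l j) w) = (l, j) ↔
        cellIdx δ γ w = (0, 0) := by
      rw [cellIdx_eq_iff hδ hγ (halfPlaneAct_mem hz hw), cellIdx_eq_iff hδ hγ hw]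
      simp only [halfPlaneAct, latticePoint_re, latticePoint_im]
      set H := (2 : ℝ) ^ (γ * j)
      have e1 : δ ^ 2 / 8 * l * H ≤ H * w.re + δ ^ 2 / 8 * l * H ↔ 0 ≤ w.re := by
        rw [le_add_iff_nonneg_left, mul_nonneg_iff_of_pos_left hpos]
      have e2 : H * w.re + δ ^ 2 / 8 * l * H < δ ^ 2 / 8 * (l + 1) * H ↔ w.re < δ ^ 2 / 8 := by
        rw [← mul_lt_mul_iff_right₀ (b := w.re) hpos]
        constructor <;> intro <;> linarith
      have e3 : H ≤ H * w.im ↔ 1 ≤ w.im := le_mul_iff_one_le_right hpos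
      have e4 : H * w.im < 2 ^ γ * H ↔ w.im < 2 ^ γ := by
        rw [mul_comm, mul_lt_mul_iff_left₀ hpos]
      rw [e1, e2, e3, e4]
      simp
    by_cases hc : cellIdx δ γ w = (0, 0)
    · rw [indicator_of_mem (show _ ∈ cellIdx δ γ ⁻¹' {(l, j)} from hiff.2 hc), indicator_of_mem (show _ ∈ cellIdx δ γ ⁻¹' {(0, 0)} from hc)]
      rfl
    · rw [indicator_of_notMem (show _ ∉ cellIdx δ γ ⁻¹' {(l, j)} from fun h => hc (hiff.1 h)),
        indicator_of_notMem (show _ ∉ cellIdx δ γ ⁻¹' {(0, 0)} from hc)]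
  rw [lintegral_congr_ae ((ae_mem_upperHalf α).mono e), lintegral_indicator_one (hmeas _)] at h
  rw [cellVol, h, latticeWeight_eq, ← mul_assoc, ← ENNReal.ofReal_mul (by positivity),
    ← Real.rpow_add hpos]
  simp

/-- Integrals of functions that are constant on the cells. -/
lemma lintegral_cellIdx (α : ℝ) (hδ : 0 < δ) (hγ : 0 < γ) (A : ℤ × ℤ → ℝ≥0∞) :
    ∫⁻ w, A (cellIdx δ γ w) ∂(weightedVolume α) =
      cellVol α δ γ * ∑' p : ℤ × ℤ, A p * ENNReal.ofReal (latticeWeight α γ p.2) := by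
  have hm := measurable_cellIdx δ γ
  rw [← lintegral_map (measurable_of_countable A) hm, lintegral_countable',
    ← ENNReal.tsum_mul_left]
  refine tsum_congr fun p => ?_
  rw [Measure.map_apply hm (measurableSet_singleton p), weightedVolume_cell α hδ hγ p.1 p.2]
  ring

/-- A lower bound for the measure of a cell that is uniform in the admissible exponents. -/
lemma cellVol_lower (α : ℝ) (hδ : 0 < δ) (hδ1 : δ < 1) :
    ∃ m : ℝ, 0 < m ∧ ∀ γ, IsLatticeExponent δ γ → ENNReal.ofReal m ≤ cellVol α δ γ := by
  set γ₀ := Real.log ((1 + δ ^ 2 / 20) / (1 - δ ^ 2 / 20)) / (4 * Real.log 2)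
  have hγ₀ : 0 < γ₀ := by
    have : 0 < δ ^ 2 := by positivity
    have : δ ^ 2 < 1 := by nlinarith
    have h1 : 1 < (1 + δ ^ 2 / 20) / (1 - δ ^ 2 / 20) := by
      rw [one_lt_div (by linarith)]; linarith
    have := Real.log_pos h1
    have := Real.log_pos one_lt_two
    positivity
  have hone : (1 : ℝ) < 2 ^ γ₀ := Real.one_lt_rpow one_lt_two hγ₀
  set U : Set ℂ := {w | 0 < w.re} ∩ {w | w.re < δ ^ 2 / 8} ∩ ({w | 1 < w.im} ∩ {w | w.im < 2 ^ γ₀})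
  have hU : IsOpen U :=
    ((isOpen_lt continuous_const Complex.continuous_re).inter
      (isOpen_lt Complex.continuous_re continuous_const)).inter
    ((isOpen_lt continuous_const Complex.continuous_im).inter
      (isOpen_lt Complex.continuous_im continuous_const))
  have hne : U.Nonempty := by
    refine ⟨⟨δ ^ 2 / 16, (1 + 2 ^ γ₀) / 2⟩, ⟨?_, ?_⟩, ?_, ?_⟩ <;> simp only [mem_ofPred_eq]
    · positivity
    · have : 0 < δ ^ 2 := by positivity
      linarith
    · linarith
    · linarith
  have hsub : U ⊆ upperHalf := fun w hw =>
    lt_trans (b := (1 : ℝ)) (c := w.im) one_pos hw.2.1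
  have hpos := weightedVolume_pos_of_isOpen α hU hne hsub
  obtain ⟨m, hm0, hm⟩ := ENNReal.lt_iff_exists_nnreal_btwn.1 hpos
  refine ⟨m, by exact_mod_cast hm0, fun γ hγ => ?_⟩
  rw [ENNReal.ofReal_coe_nnreal]
  refine hm.le.trans (measure_mono fun w hw => ?_)
  refine (cellIdx_eq_iff hδ (hγ.pos hδ hδ1) (hsub hw) 0 0).2 ?_
  obtain ⟨⟨h1, h2⟩, h3, h4⟩ := hw
  simp only [mem_ofPred_eq] at h1 h2 h3 h4
  have h5 : (2 : ℝ) ^ γ₀ ≤ 2 ^ γ := Real.rpow_le_rpow_of_exponent_le one_le_two hγ.1.le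
  simp
  refine ⟨⟨h1.le, h2⟩, h3.le, by linarith⟩

lemma cellVol_upper (α : ℝ) :
    ∃ m : ℝ, 1 ≤ m ∧ ∀ δ γ, 0 < δ → δ < 1 → IsLatticeExponent δ γ →
      cellVol α δ γ ≤ ENNReal.ofReal m := by
  set K : Set ℂ := Metric.closedBall 0 3 ∩ {w | 1 ≤ w.im ∧ w.im ≤ 2}
  have hK : weightedVolume α K < ∞ := by
    have hKm : MeasurableSet K := by
      refine measurableSet_closedBall.inter ?_
      exact (measurableSet_le measurable_const Complex.measurable_im).inter
        (measurableSet_le Complex.measurable_im measurable_const)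
    rw [weightedVolume, withDensity_apply _ hKm]
    have hb : ∀ w ∈ K, ENNReal.ofReal (w.im ^ α) ≤ ENNReal.ofReal (2 ^ |α|) := by
      intro w hw
      apply ENNReal.ofReal_le_ofReal
      exact (Real.rpow_le_rpow_of_exponent_le hw.2.1 (le_abs_self α)).trans
        (Real.rpow_le_rpow (by linarith [hw.2.1]) hw.2.2 (abs_nonneg α))
    refine (setLIntegral_mono' hKm hb).trans_lt ?_
    rw [setLIntegral_const]
    refine ENNReal.mul_lt_top ENNReal.ofReal_lt_top ?_
    refine (Measure.restrict_apply_le _ _).trans_lt ?_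
    exact (measure_mono inter_subset_left).trans_lt measure_closedBall_lt_top
  refine ⟨max 1 (weightedVolume α K).toReal, le_max_left _ _, fun δ γ hδ hδ1 hγ => ?_⟩
  refine le_trans ?_ (ENNReal.ofReal_le_ofReal (le_max_right _ _))
  rw [ENNReal.ofReal_toReal hK.ne, cellVol]
  refine measure_mono_ae ((ae_mem_upperHalf α).mono fun w hw hc => ?_)
  obtain ⟨⟨h1, h2⟩, h3, h4⟩ := (cellIdx_eq_iff hδ (hγ.pos hδ hδ1) hw 0 0).1 hc
  have h5 := hγ.two_rpow_le hδ hδ1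
  have h6 : δ ^ 2 < 1 := by nlinarith
  simp at h1 h2 h3 h4
  refine ⟨?_, h3, by linarith⟩
  rw [mem_closedBall_zero_iff]
  refine (Complex.norm_le_abs_re_add_abs_im w).trans ?_
  rw [abs_of_nonneg h1, abs_of_nonneg (by linarith)]
  linarith

end Lattice

/-! ### The atomic series -/

section Atoms

variable {α δ γ : ℝ} {Φ : ℝ → ℝ}

/-- The function on `ℂ₊` that is constant on the lattice cells, with value `|μ_{l,j}|` on the
cell `(l, j)`. -/
def stepFun (δ γ : ℝ) (μ : ℤ → ℤ → ℂ) (w : ℂ) : ℝ≥0∞ :=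
  ‖μ (cellIdx δ γ w).1 (cellIdx δ γ w).2‖ₑ

lemma measurable_comp_cellIdx (δ γ : ℝ) (A : ℤ × ℤ → ℝ≥0∞) :
    Measurable fun w => A (cellIdx δ γ w) :=
  (measurable_of_countable A).comp (measurable_cellIdx δ γ)

lemma measurable_stepFun (δ γ : ℝ) (μ : ℤ → ℤ → ℂ) : Measurable (stepFun δ γ μ) :=
  measurable_comp_cellIdx δ γ fun p => ‖μ p.1 p.2‖ₑ

/-- The modular of a sequence is, up to the measure of a cell, the modular of its step
function. -/
lemma lintegral_extPhi_stepFun (α : ℝ) (hδ : 0 < δ) (hγ : 0 < γ) (Φ : ℝ → ℝ) (μ : ℤ → ℤ → ℂ)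
    {lam : ℝ} (hlam : 0 < lam) :
    ∫⁻ w, extPhi Φ (stepFun δ γ μ w / ENNReal.ofReal lam) ∂(weightedVolume α) =
      cellVol α δ γ *
        ∑' (j : ℤ) (l : ℤ), ENNReal.ofReal (Φ (‖μ l j‖ / lam) * latticeWeight α γ j) := by
  have h := lintegral_cellIdx α hδ hγ
    fun p => extPhi Φ (‖μ p.1 p.2‖ₑ / ENNReal.ofReal lam)
  rw [ENNReal.tsum_comm, ← ENNReal.tsum_prod (f := fun l j =>
    ENNReal.ofReal (Φ (‖μ l j‖ / lam) * latticeWeight α γ j))]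
  refine h.trans ?_
  congr 2 with p
  rw [extPhi_enorm_div _ hlam, ENNReal.ofReal_mul' (latticeWeight_pos α γ p.2).le]

/-- Sums over the lattice against the kernel are dominated by the positive Bergman operator. -/
lemma tsum_absKernel_le (hα : -1 < α) (hδ : 0 < δ) (hδ1 : δ < 1) (hγ : IsLatticeExponent δ γ)
    (A : ℤ × ℤ → ℝ≥0∞) {z : ℂ} (hz : z ∈ upperHalf) :
    cellVol α δ γ * ∑' p : ℤ × ℤ, A p * ENNReal.ofReal (absKernel α z (latticePoint δ γ p.1 p.2)) *
        ENNReal.ofReal (latticeWeight α γ p.2) ≤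
      ENNReal.ofReal (2 ^ (α + 2)) * posOp α (fun w => A (cellIdx δ γ w)) z := by
  have hm : Measurable fun w => ENNReal.ofReal (absKernel α z w) * A (cellIdx δ γ w) :=
    (((measurable_absKernel α).comp measurable_prodMk_left).ennreal_ofReal).mul
      (measurable_comp_cellIdx δ γ A)
  rw [← lintegral_cellIdx α hδ (hγ.pos hδ hδ1) (fun p : ℤ × ℤ =>
    A p * ENNReal.ofReal (absKernel α z (latticePoint δ γ p.1 p.2))), posOp,
    ← lintegral_const_mul _ hm]
  refine lintegral_mono_ae ((ae_mem_upperHalf α).mono fun w hw => ?_)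
  have hw' : 0 < w.im := hw
  have h1 := norm_sub_cellPoint_le' hδ hδ1 hγ hw
  have h2 : ‖w - cellPoint δ γ w‖ ≤ w.im / 2 := by
    have : δ ^ 2 < 1 := by nlinarith
    nlinarith
  rw [mul_comm (A _), ← mul_assoc, ← ENNReal.ofReal_mul (by positivity)]
  gcongr
  exact absKernel_le_right hα hz hw h2

lemma enorm_atom (α δ γ : ℝ) (μ : ℤ → ℤ → ℂ) (z : ℂ) (l j : ℤ) :
    ‖atom α δ γ μ z l j‖ₑ = ‖μ l j‖ₑ * ENNReal.ofReal (absKernel α z (latticePoint δ γ l j)) *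
      ENNReal.ofReal (latticeWeight α γ j) := by
  rw [atom, enorm_mul, enorm_mul, ← ofReal_norm (kernel _ _ _), norm_kernel,
    ← ofReal_norm ((latticeWeight α γ j : ℝ) : ℂ), Complex.norm_real,
    Real.norm_of_nonneg (latticeWeight_pos α γ j).le]

lemma summable_of_tsum_enorm_ne_top {ι : Type*} {f : ι → ℂ} (h : ∑' i, ‖f i‖ₑ ≠ ∞) :
    Summable f := by
  refine Summable.of_norm ?_
  have := ENNReal.summable_toReal h
  simpa using this

lemma enorm_tsum_le_tsum_enorm_of_complex {ι : Type*} (f : ι → ℂ) : ‖∑' i, f i‖ₑ ≤ ∑' i, ‖f i‖ₑ := by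
  rcases eq_or_ne (∑' i, ‖f i‖ₑ) ∞ with htop | htop
  · simp [htop]
  have hs := ENNReal.summable_toReal htop
  simp only [toReal_enorm] at hs
  have e : ∑' i, ‖f i‖ₑ = ENNReal.ofReal (∑' i, ‖f i‖) := by
    rw [ENNReal.ofReal_tsum_of_nonneg (fun _ => norm_nonneg _) hs]
    simp [ofReal_norm]
  rw [e, ← ofReal_norm]
  exact ENNReal.ofReal_le_ofReal (norm_tsum_le_tsum_norm hs)

lemma tsum_enorm_atom_le (hα : -1 < α) (hδ : 0 < δ) (hδ1 : δ < 1) (hγ : IsLatticeExponent δ γ)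
    (μ : ℤ → ℤ → ℂ) {z : ℂ} (hz : z ∈ upperHalf) {m : ℝ} (hm : 0 < m)
    (hmV : ENNReal.ofReal m ≤ cellVol α δ γ) :
    ∑' p : ℤ × ℤ, ‖atom α δ γ μ z p.1 p.2‖ₑ ≤
      ENNReal.ofReal (2 ^ (α + 2) / m) * posOp α (stepFun δ γ μ) z := by
  have h := tsum_absKernel_le hα hδ hδ1 hγ (fun p => ‖μ p.1 p.2‖ₑ) hz
  simp only [← enorm_atom] at h
  rw [ENNReal.ofReal_div_of_pos hm, div_eq_mul_inv, mul_right_comm, ← div_eq_mul_inv,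
    ENNReal.le_div_iff_mul_le (by simp [hm]) (by simp), mul_comm]
  exact (mul_le_mul_left hmV _).trans h

lemma atomicSum_eq {μ : ℤ → ℤ → ℂ} {z : ℂ}
    (h : Summable fun p : ℤ × ℤ => atom α δ γ μ z p.1 p.2) :
    atomicSum α δ γ μ z = cConst α * ∑' p : ℤ × ℤ, atom α δ γ μ z p.1 p.2 := by
  have h2 := Summable.tsum_prod h.prod_symm
  simp only [Prod.fst_swap, Prod.snd_swap] at h2
  rw [atomicSum, ← h2, ← (Equiv.prodComm ℤ ℤ).tsum_eq]
  rfl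

lemma enorm_cConst (α : ℝ) : ‖cConst α‖ₑ = ENNReal.ofReal (2 ^ (α + 2)) := by
  rw [cConst, ← ofReal_norm, Complex.norm_real, Real.norm_of_nonneg (by positivity)]

lemma cConst_ne_zero (α : ℝ) : cConst α ≠ 0 := by
  rw [cConst, Complex.ofReal_ne_zero]; positivity

/-- If the positive Bergman operator is finite on the step function of `μ`, then the atomic series
of `μ` converges absolutely to a holomorphic function that this operator dominates. -/
lemma atomicSum_of_posOp_ne_top (hα : -1 < α) (hδ : 0 < δ) (hδ1 : δ < 1)
    (hγ : IsLatticeExponent δ γ) {μ : ℤ → ℤ → ℂ} {m : ℝ} (hm : 0 < m)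
    (hmV : ENNReal.ofReal m ≤ cellVol α δ γ)
    (hfin : ∀ z ∈ upperHalf, posOp α (stepFun δ γ μ) z ≠ ∞) :
    AtomicSummable α δ γ μ ∧ DifferentiableOn ℂ (atomicSum α δ γ μ) upperHalf ∧
      ∀ z ∈ upperHalf, ‖atomicSum α δ γ μ z‖ₑ ≤
        ENNReal.ofReal (2 ^ (α + 2) * (2 ^ (α + 2) / m)) * posOp α (stepFun δ γ μ) z := by
  have hle := fun z hz => tsum_enorm_atom_le hα hδ hδ1 hγ μ (z := z) hz hm hmV
  have hne : ∀ z ∈ upperHalf, ∑' p : ℤ × ℤ, ‖atom α δ γ μ z p.1 p.2‖ₑ ≠ ∞ := fun z hz =>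
    ne_top_of_le_ne_top (ENNReal.mul_ne_top ENNReal.ofReal_ne_top (hfin z hz)) (hle z hz)
  have hsum : AtomicSummable α δ γ μ := fun z hz => summable_of_tsum_enorm_ne_top (hne z hz)
  refine ⟨hsum, fun z₀ hz₀ => DifferentiableAt.differentiableWithinAt ?_, fun z hz => ?_⟩
  · have hz₀' : 0 < z₀.im := hz₀
    have hmem : ∀ z ∈ Metric.ball z₀ (z₀.im / 2), z ∈ upperHalf ∧ ‖z₀ - z‖ ≤ z₀.im / 2 := by
      intro z hz
      have h1 : ‖z₀ - z‖ < z₀.im / 2 := by simpa [dist_eq_norm, norm_sub_rev] using hz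
      have h2 := (abs_le.1 (Complex.abs_im_le_norm (z₀ - z))).2
      rw [Complex.sub_im] at h2
      refine ⟨?_, h1.le⟩
      change 0 < z.im
      linarith
    have hu : Summable fun p : ℤ × ℤ => 2 ^ (α + 2) * ‖atom α δ γ μ z₀ p.1 p.2‖ :=
      (hsum z₀ hz₀).norm.mul_left _
    have hd : DifferentiableOn ℂ (fun z => ∑' p : ℤ × ℤ, atom α δ γ μ z p.1 p.2)
        (Metric.ball z₀ (z₀.im / 2)) := by
      refine Complex.differentiableOn_tsum_of_summable_norm hu (fun p z hz => ?_)
        Metric.isOpen_ball fun p z hz => ?_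
      · refine DifferentiableAt.differentiableWithinAt ?_
        unfold atom
        exact ((differentiableAt_kernel α (hmem z hz).1 (latticePoint_mem δ γ p.1 p.2)).const_mul
          _).mul_const _
      · have := absKernel_le_left hα hz₀ (latticePoint_mem δ γ p.1 p.2) (hmem z hz).2
        simp only [atom, norm_mul, norm_kernel]
        calc _ ≤ ‖μ p.1 p.2‖ * (2 ^ (α + 2) * absKernel α z₀ (latticePoint δ γ p.1 p.2)) *
              ‖((latticeWeight α γ p.2 : ℝ) : ℂ)‖ := by gcongr
          _ = _ := by ring
    have hball : Metric.ball z₀ (z₀.im / 2) ∈ 𝓝 z₀ := Metric.ball_mem_nhds _ (by positivity)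
    refine ((hd.differentiableAt hball).const_mul (cConst α)).congr_of_eventuallyEq ?_
    filter_upwards [hball] with z hz
    exact atomicSum_eq (hsum z (hmem z hz).1)
  · rw [atomicSum_eq (hsum z hz), enorm_mul, enorm_cConst, ENNReal.ofReal_mul (by positivity),
      mul_assoc]
    gcongr
    exact (enorm_tsum_le_tsum_enorm_of_complex _).trans (hle z hz)

lemma ModBound.memSeq (hΦ : ClassU Φ) (hδ : 0 < δ) (hγ : 0 < γ) {μ : ℤ → ℤ → ℂ} {lam : ℝ}
    (hlam : 0 < lam) {m : ℝ} (hm : 0 < m) (hmV : ENNReal.ofReal m ≤ cellVol α δ γ)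
    (h : ModBound α Φ (stepFun δ γ μ) lam) : MemSeq α γ Φ μ := by
  -- Passing from `lam` to `c * lam` divides the modular by `c`, by convexity.
  set c := max 1 m⁻¹
  have hc : 1 ≤ c := le_max_left _ _
  have hc0 : 0 < c := by positivity
  have hV0 : cellVol α δ γ ≠ 0 := (lt_of_lt_of_le (by simpa using hm) hmV).ne'
  have hsum : ∑' (j : ℤ) (l : ℤ), ENNReal.ofReal (Φ (‖μ l j‖ / lam) * latticeWeight α γ j) ≤
      ENNReal.ofReal c := by
    rw [ModBound, lintegral_extPhi_stepFun α hδ hγ Φ μ hlam] at h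
    have h2 := (mul_le_mul_left hmV _).trans h
    rw [mul_comm, ← ENNReal.le_div_iff_mul_le (by simp [hm]) (by simp), one_div,
      ← ENNReal.ofReal_inv_of_pos hm] at h2
    exact h2.trans (ENNReal.ofReal_le_ofReal (le_max_right _ _))
  refine lt_of_le_of_lt (iInf₂_le (c * lam) ⟨by positivity, ?_⟩) ENNReal.ofReal_lt_top
  have hpt : ∀ (j l : ℤ), ENNReal.ofReal (Φ (‖μ l j‖ / (c * lam)) * latticeWeight α γ j) ≤
      (ENNReal.ofReal c)⁻¹ * ENNReal.ofReal (Φ (‖μ l j‖ / lam) * latticeWeight α γ j) := by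
    intro j l
    have hw := (latticeWeight_pos α γ j).le
    rw [ENNReal.ofReal_mul' hw, ENNReal.ofReal_mul' hw, ← mul_assoc]
    gcongr
    have := hΦ.extPhi_div_le hc (ENNReal.ofReal (‖μ l j‖ / lam))
    rw [← ENNReal.ofReal_div_of_pos hc0, extPhi_ofReal (by positivity),
      extPhi_ofReal (by positivity), div_eq_mul_inv (ENNReal.ofReal _), mul_comm,
      div_div, mul_comm lam] at this
    exact this
  calc _ ≤ ∑' (j : ℤ) (l : ℤ), (ENNReal.ofReal c)⁻¹ *
        ENNReal.ofReal (Φ (‖μ l j‖ / lam) * latticeWeight α γ j) :=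
        ENNReal.tsum_le_tsum fun j => ENNReal.tsum_le_tsum fun l => hpt j l
    _ ≤ (ENNReal.ofReal c)⁻¹ * ENNReal.ofReal c := by
        simp only [ENNReal.tsum_mul_left]
        gcongr
    _ = 1 := ENNReal.inv_mul_cancel (by simp [hc0]) (by simp)

/-- Boundedness of the synthesis operator `μ ↦ F_μ`. -/
lemma ClassU.synthesis_bound (hΦ : ClassU Φ) (hΨ : Delta2 (complementary Φ)) (hα : -1 < α)
    (hδ : 0 < δ) (hδ1 : δ < 1) :
    ∃ C₁ : ℝ, 0 < C₁ ∧ ∀ γ : ℝ, IsLatticeExponent δ γ →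
      ∀ μ : ℤ → ℤ → ℂ, MemSeq α γ Φ μ →
        AtomicSummable α δ γ μ ∧ MemBergman α Φ (atomicSum α δ γ μ) ∧
        bergmanNorm α Φ (atomicSum α δ γ μ) ≤ ENNReal.ofReal C₁ * seqNorm α γ Φ μ := by
  obtain ⟨M, hM, hbdd⟩ := hΦ.exists_posOp_modBound hΨ hα
  obtain ⟨m, hm, hmV⟩ := cellVol_lower α hδ hδ1
  obtain ⟨m', hm', hmV'⟩ := cellVol_upper α
  have hm'0 : 0 < m' := by linarith
  set K : ℝ := 2 ^ (α + 2) * (2 ^ (α + 2) / m)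
  have hK : 0 < K := by positivity
  refine ⟨K * (M * m'), by positivity, fun γ hγ μ hμ => ?_⟩
  have hγ0 := hγ.pos hδ hδ1
  have hstep : ∀ lam : ℝ, 0 < lam ∧ ∑' (j : ℤ) (l : ℤ),
      ENNReal.ofReal (Φ (‖μ l j‖ / lam) * latticeWeight α γ j) ≤ 1 →
      ModBound α Φ (posOp α (stepFun δ γ μ)) (M * (m' * lam)) := by
    rintro lam ⟨hlam, hle⟩
    refine hbdd _ _ (measurable_stepFun δ γ μ) (by positivity) ?_
    refine ModBound.of_le_ofReal hΦ hm' (measurable_stepFun δ γ μ) ?_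
    rw [lintegral_extPhi_stepFun α hδ hγ0 Φ μ hlam]
    exact (mul_le_of_le_one_right' hle).trans (hmV' δ γ hδ hδ1 hγ)
  obtain ⟨lam₀, hlam₀⟩ : ∃ lam : ℝ, 0 < lam ∧ ∑' (j : ℤ) (l : ℤ),
      ENNReal.ofReal (Φ (‖μ l j‖ / lam) * latticeWeight α γ j) ≤ 1 := by
    by_contra! hcon
    have : seqNorm α γ Φ μ = ∞ := by
      rw [seqNorm]
      simp only [iInf_eq_top]
      rintro lam ⟨h1, h2⟩
      exact absurd h2 (not_le.2 (hcon lam h1))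
    rw [MemSeq, this] at hμ
    exact lt_irrefl _ hμ
  have hfin : ∀ z ∈ upperHalf, posOp α (stepFun δ γ μ) z ≠ ∞ := by
    intro z hz
    obtain ⟨D, -, hDz⟩ := hΦ.exists_posOp_le hα hz
    have := hlam₀.1
    exact ne_top_of_le_ne_top ENNReal.ofReal_ne_top
      (hDz _ _ (measurable_stepFun δ γ μ) (by positivity) (hstep lam₀ hlam₀))
  obtain ⟨h1, h2, h3⟩ := atomicSum_of_posOp_ne_top hα hδ hδ1 hγ hm (hmV γ hγ) hfin
  have hnorm : bergmanNorm α Φ (atomicSum α δ γ μ) ≤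
      ENNReal.ofReal (K * (M * m')) * seqNorm α γ Φ μ := by
    rw [seqNorm, ENNReal.mul_iInf_of_ne (by simp; positivity) ENNReal.ofReal_ne_top]
    refine le_iInf fun lam => ?_
    rw [ENNReal.mul_iInf_of_ne (by simp; positivity) ENNReal.ofReal_ne_top]
    refine le_iInf fun hlam => ?_
    have hlam0 := hlam.1
    rw [bergmanNorm_eq, ← ENNReal.ofReal_mul (by positivity)]
    refine iInf₂_le _ ⟨by positivity, ?_⟩
    have := ((hstep lam hlam).const_mul hK).mono hΦ (g := absOn (atomicSum α δ γ μ))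
      fun z hz => by rw [absOn_of_mem hz]; exact h3 z hz
    convert this using 1
    ring
  exact ⟨h1, ⟨h2, hnorm.trans_lt (ENNReal.mul_lt_top ENNReal.ofReal_lt_top hμ)⟩, hnorm⟩

end Atoms

/-! ### Riemann sums of the reproducing formula -/

section Decomposition

variable {α δ γ : ℝ} {Φ : ℝ → ℝ}

lemma integral_cellIdx (α : ℝ) (hδ : 0 < δ) (hγ : 0 < γ) {B : ℤ × ℤ → ℂ}
    (hint : Integrable (fun w => B (cellIdx δ γ w)) (weightedVolume α)) :
    ∫ w, B (cellIdx δ γ w) ∂(weightedVolume α) =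
      (cellVol α δ γ).toReal * ∑' p : ℤ × ℤ, B p * (latticeWeight α γ p.2 : ℂ) := by
  have hm := measurable_cellIdx δ γ
  have hB : AEStronglyMeasurable B (Measure.map (cellIdx δ γ) (weightedVolume α)) :=
    (measurable_of_countable B).aestronglyMeasurable
  have hint' : Integrable B (Measure.map (cellIdx δ γ) (weightedVolume α)) :=
    (integrable_map_measure hB hm.aemeasurable).2 hint
  rw [← integral_map hm.aemeasurable hB, integral_countable hint', ← tsum_mul_left]
  refine tsum_congr fun p => ?_
  rw [measureReal_def, Measure.map_apply hm (measurableSet_singleton p),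
    weightedVolume_cell α hδ hγ p.1 p.2, ENNReal.toReal_mul,
    ENNReal.toReal_ofReal (latticeWeight_pos α γ p.2).le, Complex.real_smul]
  push_cast
  ring

/-- The coefficients `(|cell| / (c c_α)) F(z_{l,j})`, for which `F_μ` is a Riemann sum of the
reproducing formula with constant `c`. -/
def sampleSeq (c : ℂ) (α δ γ : ℝ) (F : ℂ → ℂ) (l j : ℤ) : ℂ :=
  ((cellVol α δ γ).toReal : ℂ) / (c * cConst α) * F (latticePoint δ γ l j)

/-- The error of the Riemann sum is small compared with the square of the positive Bergman
operator. -/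
lemma exists_remainder_bound (hα : -1 < α) :
    ∃ (c : ℂ) (R : ℝ), 0 < R ∧ ∀ δ : ℝ, 0 < δ → δ < 1 → ∀ γ, IsLatticeExponent δ γ →
      ∀ F : ℂ → ℂ, DifferentiableOn ℂ F upperHalf →
      (∀ z ∈ upperHalf, posOp α (absOn F) z ≠ ∞) →
      (∀ z ∈ upperHalf, posOp α (posOp α (absOn F)) z ≠ ∞) →
      (∀ z ∈ upperHalf, ‖F z‖ₑ ≤ ENNReal.ofReal R * posOp α (absOn F) z) ∧
      (∀ w ∈ upperHalf, stepFun δ γ (sampleSeq c α δ γ F) w ≤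
        ENNReal.ofReal (R * ((cellVol α δ γ).toReal + 1)) * posOp α (absOn F) w) ∧
      (∀ z ∈ upperHalf, AtomicSummable α δ γ (sampleSeq c α δ γ F) →
        ‖F z - atomicSum α δ γ (sampleSeq c α δ γ F) z‖ₑ ≤
          ENNReal.ofReal (R * δ ^ 2) * posOp α (posOp α (absOn F)) z) := by
  obtain ⟨c, hc, hrep⟩ := reproducing hα
  obtain ⟨c₁, hc₁, hpt⟩ := exists_enorm_le_posOp hα
  have hL := lipConst_pos hα
  have hc' : 0 < ‖c‖ := norm_pos_iff.2 hc
  have hcc := cConst_ne_zero α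
  have hcc' : 0 < ‖c * cConst α‖ := norm_pos_iff.2 (mul_ne_zero hc hcc)
  set K : ℝ := 2 ^ (α + 2) with hKdef
  have hK : 0 < K := by positivity
  set R₁ := ‖c * cConst α‖⁻¹ * (c₁ * K)
  set R₂ := ‖c‖⁻¹ * ((lipConst α * c₁ + K * c₁) / 3)
  refine ⟨c, c₁ + R₁ + R₂, by positivity, fun δ hδ hδ1 γ hγ F hF hfin hfin2 => ?_⟩
  obtain ⟨hpt1, hpt2⟩ := hpt F hF
  have hδ2 : 0 < δ ^ 2 := by positivity
  have hδ21 : δ ^ 2 < 1 := by nlinarith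
  have hγ0 := hγ.pos hδ hδ1
  set g := absOn F
  have hg : Measurable g := measurable_absOn hF
  have hTg := measurable_posOp α hg
  have hR₁ : 0 < R₁ := by positivity
  have hR₂ : 0 < R₂ := by positivity
  have hcell : ∀ w ∈ upperHalf, ‖w - cellPoint δ γ w‖ ≤ δ ^ 2 / 3 * w.im := fun w hw =>
    norm_sub_cellPoint_le' hδ hδ1 hγ hw
  have hcell' : ∀ w ∈ upperHalf, ‖w - cellPoint δ γ w‖ ≤ w.im / 2 := fun w hw => by
    have : 0 < w.im := hw
    have := hcell w hw
    nlinarith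
  have hcp : ∀ w, cellPoint δ γ w ∈ upperHalf := fun w => latticePoint_mem δ γ _ _
  have hFcell : ∀ w ∈ upperHalf, ‖F (cellPoint δ γ w)‖ₑ ≤
      ENNReal.ofReal (c₁ * K) * posOp α g w := by
    intro w hw
    refine (hpt1 _ (hcp w)).trans ?_
    rw [ENNReal.ofReal_mul hc₁.le, mul_assoc]
    gcongr
    exact posOp_le_of_near hα hg hw (hcell' w hw)
  refine ⟨fun z hz => (hpt1 z hz).trans ?_, fun w hw => ?_, fun z hz hsum => ?_⟩
  · gcongr
    linarith
  · have e : stepFun δ γ (sampleSeq c α δ γ F) w =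
        ENNReal.ofReal ((cellVol α δ γ).toReal * ‖c * cConst α‖⁻¹) * ‖F (cellPoint δ γ w)‖ₑ := by
      rw [stepFun, sampleSeq, enorm_mul, ← ofReal_norm (_ / _), norm_div, Complex.norm_real,
        Real.norm_of_nonneg ENNReal.toReal_nonneg, div_eq_mul_inv]
      rfl
    rw [e]
    refine (mul_le_mul_right (hFcell w hw) _).trans ?_
    rw [← mul_assoc, ← ENNReal.ofReal_mul (by positivity)]
    refine mul_le_mul_left (ENNReal.ofReal_le_ofReal ?_) _
    have h0 : 0 ≤ (cellVol α δ γ).toReal := ENNReal.toReal_nonneg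
    calc (cellVol α δ γ).toReal * ‖c * cConst α‖⁻¹ * (c₁ * K) = R₁ * (cellVol α δ γ).toReal := by
          simp only [R₁]; ring
      _ ≤ (c₁ + R₁ + R₂) * ((cellVol α δ γ).toReal + 1) := by
          gcongr <;> linarith
  · set B : ℤ × ℤ → ℂ := fun p =>
      kernel α z (latticePoint δ γ p.1 p.2) * F (latticePoint δ γ p.1 p.2)
    have hBeq : ∀ w, B (cellIdx δ γ w) = kernel α z (cellPoint δ γ w) * F (cellPoint δ γ w) :=
      fun w => rfl
    have hκm : Measurable fun w => ENNReal.ofReal (absKernel α z w) * posOp α g w :=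
      (((measurable_absKernel α).comp measurable_prodMk_left).ennreal_ofReal).mul hTg
    have hBint : Integrable (fun w => B (cellIdx δ γ w)) (weightedVolume α) := by
      refine ⟨((measurable_of_countable B).comp (measurable_cellIdx δ γ)).aestronglyMeasurable, ?_⟩
      have hle : ∀ w ∈ upperHalf, ‖B (cellIdx δ γ w)‖ₑ ≤ ENNReal.ofReal (K * (c₁ * K)) *
          (ENNReal.ofReal (absKernel α z w) * posOp α g w) := by
        intro w hw
        rw [hBeq, enorm_mul, ← ofReal_norm (kernel _ _ _), norm_kernel]
        refine (mul_le_mul' (ENNReal.ofReal_le_ofReal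
          (absKernel_le_right hα hz hw (hcell' w hw))) (hFcell w hw)).trans_eq ?_
        rw [ENNReal.ofReal_mul hK.le, ENNReal.ofReal_mul hK.le]
        ring
      refine (lintegral_mono_ae ((ae_mem_upperHalf α).mono hle)).trans_lt ?_
      rw [lintegral_const_mul _ hκm]
      exact ENNReal.mul_lt_top ENNReal.ofReal_lt_top (hfin2 z hz).lt_top
    have hS : atomicSum α δ γ (sampleSeq c α δ γ F) z =
        c⁻¹ * ∫ w, B (cellIdx δ γ w) ∂(weightedVolume α) := by
      rw [atomicSum_eq (hsum z hz), integral_cellIdx α hδ hγ0 hBint, ← tsum_mul_left,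
        ← tsum_mul_left, ← tsum_mul_left]
      refine tsum_congr fun p => ?_
      simp only [atom, sampleSeq, B]
      field_simp
    have hFz : F z = c⁻¹ * ∫ w, kernel α z w * F w ∂(weightedVolume α) := by
      rw [hrep F hF z hz (hfin z hz)]; field_simp
    have hdiff : F z - atomicSum α δ γ (sampleSeq c α δ γ F) z =
        c⁻¹ * ∫ w, (kernel α z w * F w - B (cellIdx δ γ w)) ∂(weightedVolume α) := by
      rw [integral_sub (integrable_kernel_mul α hF (hfin z hz)) hBint, mul_sub, ← hS, ← hFz]
    have hle : ∀ w ∈ upperHalf, ‖kernel α z w * F w - B (cellIdx δ γ w)‖ₑ ≤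
        ENNReal.ofReal ((lipConst α * c₁ + K * c₁) / 3 * δ ^ 2) *
          (ENNReal.ofReal (absKernel α z w) * posOp α g w) := by
      intro w hw
      have hk0 := absKernel_nonneg α z w
      have e : kernel α z w * F w - B (cellIdx δ γ w) =
          (kernel α z w - kernel α z (cellPoint δ γ w)) * F w +
            kernel α z (cellPoint δ γ w) * (F w - F (cellPoint δ γ w)) := by
        rw [hBeq]; ring
      have h1 : ‖kernel α z w - kernel α z (cellPoint δ γ w)‖ₑ ≤
          ENNReal.ofReal (lipConst α * (δ ^ 2 / 3) * absKernel α z w) := by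
        rw [← ofReal_norm]
        exact ENNReal.ofReal_le_ofReal (norm_kernel_sub_le_right hα hz hw (hcp w)
          (by linarith) (by positivity) (hcell w hw))
      have h2 : ‖kernel α z (cellPoint δ γ w)‖ₑ ≤ ENNReal.ofReal (K * absKernel α z w) := by
        rw [← ofReal_norm, norm_kernel]
        exact ENNReal.ofReal_le_ofReal (absKernel_le_right hα hz hw (hcell' w hw))
      have h3 := hpt2 w hw _ (hcp w) (δ ^ 2 / 3) (by positivity) (by linarith) (hcell w hw)
      rw [e]
      refine (enorm_add_le _ _).trans ?_
      rw [enorm_mul, enorm_mul]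
      refine (add_le_add (mul_le_mul' h1 (hpt1 w hw)) (mul_le_mul' h2 h3)).trans_eq ?_
      rw [← mul_assoc, ← mul_assoc, ← mul_assoc, ← add_mul, ← ENNReal.ofReal_mul (by positivity),
        ← ENNReal.ofReal_mul (by positivity), ← ENNReal.ofReal_add (by positivity)
        (by positivity), ← ENNReal.ofReal_mul (by positivity)]
      congr 2
      ring
    rw [hdiff, enorm_mul, ← ofReal_norm, norm_inv]
    calc _ ≤ ENNReal.ofReal ‖c‖⁻¹ *
          (ENNReal.ofReal ((lipConst α * c₁ + K * c₁) / 3 * δ ^ 2) *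
            posOp α (posOp α g) z) := by
          gcongr
          refine (enorm_integral_le_lintegral_enorm _).trans ?_
          rw [posOp.eq_def α (posOp α g), ← lintegral_const_mul _ hκm]
          exact lintegral_mono_ae ((ae_mem_upperHalf α).mono hle)
      _ = ENNReal.ofReal (R₂ * δ ^ 2) * posOp α (posOp α g) z := by
          rw [← mul_assoc, ← ENNReal.ofReal_mul (by positivity)]
          congr 2
          simp only [R₂]; ring
      _ ≤ _ := by
          gcongr
          linarith

/-- Synthesis is additive over absolutely convergent series of sequences. -/
lemma hasSum_atomicSum {μ : ℕ → ℤ → ℤ → ℂ} {z : ℂ}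
    (h : ∑' p : ℤ × ℤ, ∑' n, ‖atom α δ γ (μ n) z p.1 p.2‖ₑ ≠ ∞) :
    HasSum (fun n => atomicSum α δ γ (μ n) z)
      (cConst α * ∑' p : ℤ × ℤ, ∑' n, atom α δ γ (μ n) z p.1 p.2) := by
  have hs : Summable fun q : ℕ × (ℤ × ℤ) => atom α δ γ (μ q.1) z q.2.1 q.2.2 := by
    apply summable_of_tsum_enorm_ne_top
    rwa [ENNReal.tsum_prod (f := fun n (p : ℤ × ℤ) => ‖atom α δ γ (μ n) z p.1 p.2‖ₑ),
      ENNReal.tsum_comm]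
  have hn : ∀ n, Summable fun p : ℤ × ℤ => atom α δ γ (μ n) z p.1 p.2 := fun n =>
    hs.prod_factor n
  have e : (fun n => atomicSum α δ γ (μ n) z) =
      fun n => cConst α * ∑' p : ℤ × ℤ, atom α δ γ (μ n) z p.1 p.2 :=
    funext fun n => atomicSum_eq (hn n)
  rw [e]
  refine HasSum.mul_left _ ?_
  have hcomm : ∑' p : ℤ × ℤ, ∑' n, atom α δ γ (μ n) z p.1 p.2 =
      ∑' n, ∑' p : ℤ × ℤ, atom α δ γ (μ n) z p.1 p.2 :=
    Summable.tsum_comm (f := fun n (p : ℤ × ℤ) => atom α δ γ (μ n) z p.1 p.2) hs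
  rw [hcomm]
  exact hs.prod.hasSum

/-- The atomic decomposition: for small `δ` the Riemann sum operator differs from the identity by
an operator of norm at most `1 / 2`, and iterating the error yields the coefficients. -/
lemma ClassU.exists_decomposition (hΦ : ClassU Φ) (hΨ : Delta2 (complementary Φ)) (hα : -1 < α) :
    ∃ δ₀ : ℝ, 0 < δ₀ ∧ ∀ δ : ℝ, 0 < δ → δ < 1 → δ < δ₀ → ∀ γ : ℝ, IsLatticeExponent δ γ →
      ∀ F : ℂ → ℂ, MemBergman α Φ F → ∃ μ : ℤ → ℤ → ℂ, MemSeq α γ Φ μ ∧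
        AtomicSummable α δ γ μ ∧ ∀ z ∈ upperHalf, F z = atomicSum α δ γ μ z := by
  obtain ⟨M, hM, hbdd⟩ := hΦ.exists_posOp_modBound hΨ hα
  obtain ⟨c, R, hR, hrem⟩ := exists_remainder_bound hα
  -- With this choice the error operator has norm at most `R δ² M² ≤ 1 / 2`.
  refine ⟨Real.sqrt (1 / (2 * R * M ^ 2)), by positivity, fun δ hδ hδ1 hδ₀ γ hγ F hF => ?_⟩
  have hsmall : R * δ ^ 2 * M ^ 2 ≤ 1 / 2 := by
    have h1 := (Real.lt_sqrt hδ.le).1 hδ₀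
    rw [lt_div_iff₀ (by positivity)] at h1
    linarith
  have hγ0 := hγ.pos hδ hδ1
  obtain ⟨m, hm, hmV'⟩ := cellVol_lower α hδ hδ1
  have hmV := hmV' γ hγ
  set V := (cellVol α δ γ).toReal
  have hV : 0 ≤ V := ENNReal.toReal_nonneg
  set S : (ℂ → ℂ) → ℂ → ℂ := fun G => atomicSum α δ γ (sampleSeq c α δ γ G)
  -- One step of the iteration.
  have step : ∀ (G : ℂ → ℂ) (lam : ℝ), 0 < lam → DifferentiableOn ℂ G upperHalf →
      ModBound α Φ (absOn G) lam →
      (∀ z ∈ upperHalf, ‖G z‖ₑ ≤ ENNReal.ofReal R * posOp α (absOn G) z) ∧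
      ModBound α Φ (stepFun δ γ (sampleSeq c α δ γ G)) (R * (V + 1) * M * lam) ∧
      DifferentiableOn ℂ (fun z => G z - S G z) upperHalf ∧
      ModBound α Φ (absOn fun z => G z - S G z) (lam / 2) := by
    intro G lam hlam hG hb
    have hg := measurable_absOn hG
    have hb1 := hbdd _ _ hg hlam hb
    have hb2 := hbdd _ _ (measurable_posOp α hg) (by positivity) hb1
    have hfin1 : ∀ z ∈ upperHalf, posOp α (absOn G) z ≠ ∞ := fun z hz => by
      obtain ⟨D, -, hD⟩ := hΦ.exists_posOp_le hα hz
      exact ne_top_of_le_ne_top ENNReal.ofReal_ne_top (hD _ _ hg (by positivity) hb1)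
    have hfin2 : ∀ z ∈ upperHalf, posOp α (posOp α (absOn G)) z ≠ ∞ := fun z hz => by
      obtain ⟨D, -, hD⟩ := hΦ.exists_posOp_le hα hz
      exact ne_top_of_le_ne_top ENNReal.ofReal_ne_top
        (hD _ _ (measurable_posOp α hg) (by positivity) hb2)
    obtain ⟨h1, h2, h3⟩ := hrem δ hδ hδ1 γ hγ G hG hfin1 hfin2
    have hb3 : ModBound α Φ (stepFun δ γ (sampleSeq c α δ γ G)) (R * (V + 1) * (M * lam)) :=
      (hb1.const_mul (by positivity)).mono hΦ h2
    have hfin3 : ∀ z ∈ upperHalf, posOp α (stepFun δ γ (sampleSeq c α δ γ G)) z ≠ ∞ :=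
      fun z hz => by
        obtain ⟨D, -, hD⟩ := hΦ.exists_posOp_le hα hz
        have hms := measurable_stepFun δ γ (sampleSeq c α δ γ G)
        exact ne_top_of_le_ne_top ENNReal.ofReal_ne_top
          (hD _ _ hms (by positivity) (hbdd _ _ hms (by positivity) hb3))
    obtain ⟨hs1, hs2, -⟩ := atomicSum_of_posOp_ne_top hα hδ hδ1 hγ hm hmV hfin3
    have hd : DifferentiableOn ℂ (fun z => G z - S G z) upperHalf := hG.sub hs2
    refine ⟨h1, by convert hb3 using 1; ring, hd, ?_⟩
    have hr : 0 < R * δ ^ 2 * M ^ 2 := by positivity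
    -- Enlarge the remainder to make the factor exactly `1 / 2`.
    have hb4 := (hb2.const_mul (c := 1 / (2 * M ^ 2)) (by positivity)).mono hΦ
      (g := absOn fun z => G z - S G z) fun z hz => by
        rw [absOn_of_mem hz]
        refine (h3 z hz hs1).trans ?_
        gcongr
        rw [le_div_iff₀ (by positivity)]
        linarith
    convert hb4 using 1
    field_simp
  obtain ⟨lam, hlam, hFb⟩ : ∃ lam : ℝ, 0 < lam ∧ ModBound α Φ (absOn F) lam := by
    by_contra! hcon
    have h := hF.2
    rw [bergmanNorm_eq] at h
    refine absurd h (not_lt.2 (top_le_iff.2 ?_))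
    simp only [iInf_eq_top]
    rintro lam ⟨h1, h2⟩
    exact absurd h2 (hcon lam h1)
  set Fs : ℕ → ℂ → ℂ := fun n => (fun G z => G z - S G z)^[n] F
  have hFs : ∀ n z, Fs (n + 1) z = Fs n z - S (Fs n) z := fun n z => by
    simp only [Fs, Function.iterate_succ_apply']
  have hind : ∀ n, DifferentiableOn ℂ (Fs n) upperHalf ∧
      ModBound α Φ (absOn (Fs n)) (lam / 2 ^ n) := by
    intro n
    induction n with
    | zero => exact ⟨hF.1, by simpa [Fs] using hFb⟩
    | succ n ih =>
      obtain ⟨-, -, h3, h4⟩ := step (Fs n) _ (by positivity) ih.1 ih.2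
      have e : Fs (n + 1) = fun z => Fs n z - S (Fs n) z := funext (hFs n)
      rw [e, pow_succ, ← div_div]
      exact ⟨h3, h4⟩
  set μs : ℕ → ℤ → ℤ → ℂ := fun n => sampleSeq c α δ γ (Fs n)
  have hμs : ∀ n, ModBound α Φ (stepFun δ γ (μs n)) (R * (V + 1) * M * lam / 2 ^ n) := fun n => by
    obtain ⟨-, h2, -, -⟩ := step (Fs n) _ (by positivity) (hind n).1 (hind n).2
    convert h2 using 1
    ring
  set lam' := R * (V + 1) * M * lam
  have hlam' : 0 < lam' := by positivity
  set A : ℤ × ℤ → ℝ≥0∞ := fun p => ∑' n, ‖μs n p.1 p.2‖ₑ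
  have hA : ModBound α Φ (fun w => A (cellIdx δ γ w)) (2 * lam') :=
    ModBound.tsum hΦ (fun n => measurable_stepFun δ γ (μs n)) hlam' hμs
  have hAm := measurable_comp_cellIdx δ γ A
  have hAfin : ∀ z ∈ upperHalf, ∑' p : ℤ × ℤ, A p *
      ENNReal.ofReal (absKernel α z (latticePoint δ γ p.1 p.2)) *
        ENNReal.ofReal (latticeWeight α γ p.2) ≠ ∞ := by
    intro z hz
    obtain ⟨D, -, hD⟩ := hΦ.exists_posOp_le hα hz
    have h1 := hD _ _ hAm (by positivity) (hbdd _ _ hAm (by positivity) hA)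
    have h2 := tsum_absKernel_le hα hδ hδ1 hγ A hz
    intro htop
    rw [htop, ENNReal.mul_top ((lt_of_lt_of_le (by simpa using hm) hmV).ne')] at h2
    exact absurd (top_le_iff.1 h2) (ENNReal.mul_ne_top ENNReal.ofReal_ne_top
      (ne_top_of_le_ne_top ENNReal.ofReal_ne_top h1))
  have hApt : ∀ p, A p ≠ ∞ := by
    intro p hp
    have h1 := ENNReal.ne_top_of_tsum_ne_top (hAfin _ I_mem_upperHalf) p
    have h2 := absKernel_pos α I_mem_upperHalf (latticePoint_mem δ γ p.1 p.2)
    have h3 := latticeWeight_pos α γ p.2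
    rw [hp, ENNReal.top_mul (by simpa using h2), ENNReal.top_mul (by simpa using h3)] at h1
    exact h1 rfl
  set μ : ℤ → ℤ → ℂ := fun l j => ∑' n, μs n l j
  have hμA : ∀ w, stepFun δ γ μ w ≤ A (cellIdx δ γ w) := fun w => enorm_tsum_le_tsum_enorm_of_complex _
  have hμb : ModBound α Φ (stepFun δ γ μ) (2 * lam') := hA.mono hΦ fun w _ => hμA w
  have hterm : ∀ z (p : ℤ × ℤ), ∑' n, ‖atom α δ γ (μs n) z p.1 p.2‖ₑ = A p *
      ENNReal.ofReal (absKernel α z (latticePoint δ γ p.1 p.2)) *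
        ENNReal.ofReal (latticeWeight α γ p.2) := fun z p => by
    simp only [enorm_atom, ENNReal.tsum_mul_right, A]
  have hatom : ∀ z (p : ℤ × ℤ), atom α δ γ μ z p.1 p.2 = ∑' n, atom α δ γ (μs n) z p.1 p.2 :=
    fun z p => by simp only [atom, μ, tsum_mul_right]
  have hsummable : AtomicSummable α δ γ μ := fun z hz => by
    apply summable_of_tsum_enorm_ne_top
    refine ne_top_of_le_ne_top (hAfin z hz) (ENNReal.tsum_le_tsum fun p => ?_)
    rw [hatom, ← hterm]
    exact enorm_tsum_le_tsum_enorm_of_complex _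
  refine ⟨μ, hμb.memSeq hΦ hδ hγ0 (by positivity) hm hmV, hsummable, fun z hz => ?_⟩
  have hsum : HasSum (fun n => atomicSum α δ γ (μs n) z) (atomicSum α δ γ μ z) := by
    rw [atomicSum_eq (hsummable z hz)]
    simp only [hatom]
    refine hasSum_atomicSum ?_
    simp only [hterm]
    exact hAfin z hz
  have hpartial : ∀ N, ∑ n ∈ Finset.range N, atomicSum α δ γ (μs n) z = F z - Fs N z := by
    intro N
    induction N with
    | zero => simp [Fs]
    | succ N ih =>
      rw [Finset.sum_range_succ, ih, hFs N z]
      simp only [S, μs]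
      ring
  have hzero : Tendsto (fun N => Fs N z) atTop (𝓝 0) := by
    obtain ⟨D, hD0, hD⟩ := hΦ.exists_posOp_le hα hz
    have hb : ∀ N, ‖Fs N z‖ ≤ R * (D * (M * lam)) * (1 / 2) ^ N := by
      intro N
      obtain ⟨h1, -⟩ := step (Fs N) _ (by positivity) (hind N).1 (hind N).2
      have hg := measurable_absOn (hind N).1
      have h2 := hD _ _ hg (by positivity) (hbdd _ _ hg (by positivity) (hind N).2)
      have h3 := (h1 z hz).trans (mul_le_mul_right h2 _)
      rw [← ENNReal.ofReal_mul hR.le, ← ofReal_norm,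
        ENNReal.ofReal_le_ofReal_iff (by positivity)] at h3
      refine h3.trans_eq ?_
      rw [one_div, inv_pow]
      ring
    refine squeeze_zero_norm hb ?_
    simpa using (tendsto_pow_atTop_nhds_zero_of_lt_one (by norm_num : (0 : ℝ) ≤ 1 / 2)
      (by norm_num)).const_mul (R * (D * (M * lam)))
  have hlim := hsum.tendsto_sum_nat
  simp only [hpartial] at hlim
  have hlim2 : Tendsto (fun N => F z - Fs N z) atTop (𝓝 (F z)) := by
    simpa using tendsto_const_nhds.sub hzero
  exact tendsto_nhds_unique hlim2 hlim

end Decomposition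

end BergmanOrlicz
end

theorem theorem1 (α : ℝ) (hα : -1 < α) (Φ : ℝ → ℝ)
    (hΦ : BergmanOrlicz.ClassU Φ) (hΦ' : BergmanOrlicz.Nabla2 Φ) :
    (∀ δ : ℝ, 0 < δ → δ < 1 →
      ∃ C₁ : ℝ, 0 < C₁ ∧
        ∀ γ : ℝ, BergmanOrlicz.IsLatticeExponent δ γ →
        ∀ μ : ℤ → ℤ → ℂ, BergmanOrlicz.MemSeq α γ Φ μ →
          BergmanOrlicz.AtomicSummable α δ γ μ ∧
          BergmanOrlicz.MemBergman α Φ (BergmanOrlicz.atomicSum α δ γ μ) ∧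
          BergmanOrlicz.bergmanNorm α Φ (BergmanOrlicz.atomicSum α δ γ μ) ≤
            ENNReal.ofReal C₁ * BergmanOrlicz.seqNorm α γ Φ μ) ∧
    (∃ δ₀ : ℝ, 0 < δ₀ ∧
      ∀ δ : ℝ, 0 < δ → δ < 1 → δ < δ₀ →
      ∃ C₂ : ℝ, 0 < C₂ ∧
        ∀ γ : ℝ, BergmanOrlicz.IsLatticeExponent δ γ →
        ∀ F : ℂ → ℂ, BergmanOrlicz.MemBergman α Φ F →
          ∃ μ : ℤ → ℤ → ℂ, BergmanOrlicz.MemSeq α γ Φ μ ∧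
            BergmanOrlicz.AtomicSummable α δ γ μ ∧
            (∀ z ∈ BergmanOrlicz.upperHalf, F z = BergmanOrlicz.atomicSum α δ γ μ z) ∧
            BergmanOrlicz.bergmanNorm α Φ F ≤
              ENNReal.ofReal C₂ * BergmanOrlicz.seqNorm α γ Φ μ) := by
  refine ⟨fun δ hδ hδ1 => hΦ.synthesis_bound hΦ'.2 hα hδ hδ1, ?_⟩
  obtain ⟨δ₀, hδ₀, hdec⟩ := hΦ.exists_decomposition hΦ'.2 hα
  refine ⟨δ₀, hδ₀, fun δ hδ hδ1 hδδ₀ => ?_⟩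
  obtain ⟨C, hC, hsyn⟩ := hΦ.synthesis_bound hΦ'.2 hα hδ hδ1
  refine ⟨C, hC, fun γ hγ F hF => ?_⟩
  obtain ⟨μ, hμ, hsum, heq⟩ := hdec δ hδ hδ1 hδδ₀ γ hγ F hF
  refine ⟨μ, hμ, hsum, heq, ?_⟩
  have e : BergmanOrlicz.bergmanNorm α Φ F =
      BergmanOrlicz.bergmanNorm α Φ (BergmanOrlicz.atomicSum α δ γ μ) := by
    have : BergmanOrlicz.absOn F = BergmanOrlicz.absOn (BergmanOrlicz.atomicSum α δ γ μ) := by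
      funext z
      simp only [BergmanOrlicz.absOn]
      rw [Set.indicator_congr heq]
    rw [BergmanOrlicz.bergmanNorm_eq, BergmanOrlicz.bergmanNorm_eq, this]
  rw [e]
  exact (hsyn γ hγ μ hμ).2.2
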